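/- **Setting.** A tree MDP has finite sets $S$ (non-terminal states, with a start state $s_1$), $\Sigma$ (terminal states) and $A$ (actions, $|A|\ge 2$), transition probabilities $p(s,a,\cdot)$ on $S\cup\Sigma$, known rewards $r(s,a,s')$, a discount factor $\gamma\in[0,1]$ and a horizon $H$. Every $x\in S\cup\Sigma$ other than $s_1$ has exactly one parent pair $(s,a)$ from which it can be entered, $s_1$ has none; $s_1$ has level $1$, a non-terminal child of a state of level $h$ has level $h+1$, and all non-terminal states have level at most $H$. Thus each $\sigma\in\Sigma$ has a unique path $s_1,a_1,\dots,s_m,a_m,s_{m+1}=\sigma$; its return $\rho(\sigma)=\sum_{i=1}^m\gamma^{i-1}r(s_i,a_i,s_{i+1})$ is assumed to lie in $[0,1]$. A policy is a map $\pi:S\to A$, $\Pi$ is the set of all policies, and $V^\pi$ solves $V^\pi(s)=\sum_{s'}p(s,\pi(s),s')\,(r(s,\pi(s),s')+\gamma V^\pi(s'))$ with $V^\pi=0$ on $\Sigma$; $V(\pi)=V^\pi(s_1)$. A policy $\pi$ is consistent with $\sigma$ if $\pi(s_i)=a_i$ along the path to $\sigma$; $X(\pi)$ is the set of terminal states with which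 $\pi$ is consistent and $Y(\sigma)$ the set of policies consistent with $\sigma$. Fix an optimal policy $\pi^\star$ (one that maximises $V^\pi(s)$ for every $s$), and put $\Delta_\pi=V(\pi^\star)-V(\pi)$ for $\pi\ne\pi^\star$, $\Delta_{\pi^\star}=V(\pi^\star)-\max_{\pi\in\Pi\setminus\{\pi^\star\}}V(\pi)$, $\Delta^\epsilon_\pi=\max\{\Delta_\pi,\epsilon\}$ and $\Delta^\epsilon_\sigma=\min_{\pi\in Y(\sigma)}\Delta^\epsilon_\pi$. **Algorithm (Lucb-T).** An episode of $\pi$ starts in $s_1$ and follows $\pi$, next states being sampled from $p$, independently of the past, until a terminal state is reached. At the start of batch $t=1,2,\dots$ let $n(\sigma)$ be the number of previous episodes whose policy was consistent with $\sigma$ and $n_+(\sigma)$ the number of those that ended in $\sigma$. If some $n(\sigma)=0$, one episode of an arbitrary policy in $Y(\sigma)$, for some such $\sigma$, is played. Otherwise let $\widehat V(\pi)=\sum_{\sigma\in X(\pi)}\frac{n_+(\sigma)}{n(\sigma)}\rho(\sigma)$, $n(\pi)=\min_{\sigma\in X(\pi)}n(\sigma)$, $\delta_L(t)=\delta/(3|\Pi|t^{|\Sigma|+4})$,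 $\beta(\pi)=\sqrt{\frac{8}{3n(\pi)}\ln\frac1{\delta_L(t)}}$, $\mathrm{ucb}(\pi)=\widehat V(\pi)+\beta(\pi)$ and $\mathrm{lcb}(\pi)=\min\{\widehat V(\pi),1\}-\beta(\pi)$. Let $\pi_1$ maximise $\widehat V$ over $\Pi$ and let $\pi_2$ maximise $\mathrm{ucb}$ over $\Pi\setminus\{\pi_1\}$ (ties broken arbitrarily). If $\mathrm{lcb}(\pi_1)\ge\mathrm{ucb}(\pi_2)-\epsilon$, stop and return $\pi_1$; otherwise play one episode of $\pi_1$ and one of $\pi_2$. **Theorem.** There is an absolute constant $C>0$ such that for every tree MDP as above, every optimal policy $\pi^\star$, all $\epsilon,\delta\in(0,1)$ and every way of making the arbitrary choices, the expected number of episodes that Lucb-T plays before it stops is at most $$C\sum_{\sigma\in\Sigma}\frac{|\Sigma|}{(\Delta^\epsilon_\sigma)^2}\left(\log\frac1\delta+\log\sum_{\sigma'\in\Sigma}\frac1{(\Delta^\epsilon_{\sigma'})^2}+|S|\log|A|\right).$$ -/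

import Mathlib

open MeasureTheory
open scoped ENNReal

noncomputable section

/-- The states of a tree MDP: non-terminal states `S` and terminal states `T`. -/
inductive Node (S T : Type*) where
  | inner (s : S) : Node S T
  | leaf (σ : T) : Node S T

namespace Node

variable {S T : Type*}

/-- Nodes are either non-terminal or terminal. -/
def equivSum : S ⊕ T ≃ Node S T where
  toFun := Sum.elim inner leaf
  invFun x := match x with
    | inner s => Sum.inl s
    | leaf σ => Sum.inr σ
  left_inv := by rintro (s | σ) <;> rfl
  right_inv := by rintro (s | σ) <;> rfl

instance [Fintype S] [Fintype T] : Fintype (Node S T) := Fintype.ofEquiv _ equivSum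

instance : MeasurableSpace (Node S T) := ⊤

instance : DiscreteMeasurableSpace (Node S T) := ⟨fun _ => trivial⟩

end Node

/-- A tree MDP with non-terminal states `S`, terminal states `T` and actions `A`.
`parent x = some (s, a)` says that `x` is entered from `s` by taking action `a`; every node but
the root has exactly one such pair, and each transition goes down one edge of the tree. -/
structure TreeMDP (S T A : Type*) where
  /-- the starting state -/
  root : S
  /-- the horizon -/
  horizon : ℕ
  /-- the level of a non-terminal state -/
  level : S → ℕ
  /-- the unique state-action pair that leads to a node -/
  parent : Node S T → Option (S × A)
  /-- transition probabilities -/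
  p : S → A → PMF (Node S T)
  /-- rewards -/
  r : S → A → Node S T → ℝ
  /-- the discount factor -/
  γ : ℝ
  γ_mem : γ ∈ Set.Icc (0 : ℝ) 1
  level_root : level root = 1
  level_le : ∀ s, level s ≤ horizon
  parent_eq_none : ∀ x, parent x = none ↔ x = .inner root
  level_child : ∀ s a s', parent (.inner s') = some (s, a) → level s' = level s + 1
  parent_of_p : ∀ s a x, p s a x ≠ 0 → parent x = some (s, a)

namespace TreeMDP

variable {S T A : Type*}

/-! ### Values -/

/-- The value of `s` under the deterministic policy `π` when `n` more actions are taken. -/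
def valueAux [Fintype S] [Fintype T] (M : TreeMDP S T A) (π : S → A) : ℕ → S → ℝ
  | 0, _ => 0
  | n + 1, s => ∑ x : Node S T, (M.p s (π s) x).toReal *
      (M.r s (π s) x + M.γ * match x with
        | .inner s' => valueAux M π n s'
        | .leaf _ => 0)

/-- The value `V^π(s)`: every trajectory ends after at most `horizon` actions. -/
def value [Fintype S] [Fintype T] (M : TreeMDP S T A) (π : S → A) (s : S) : ℝ :=
  M.valueAux π M.horizon s

theorem valueAux_congr [Fintype S] [Fintype T] (M : TreeMDP S T A) (π : S → A) (n m : ℕ) (s : S)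
    (hn : M.horizon < n + M.level s) (hm : M.horizon < m + M.level s) :
    M.valueAux π n s = M.valueAux π m s := by
  induction n generalizing m s with
  | zero => have := M.level_le s; omega
  | succ n ih =>
    cases m with
    | zero => have := M.level_le s; omega
    | succ m =>
      simp only [valueAux]
      refine Finset.sum_congr rfl fun x _ => ?_
      by_cases hx : M.p s (π s) x = 0
      · simp [hx]
      · cases x with
        | leaf σ => rfl
        | inner s' =>
          have h := M.level_child _ _ _ (M.parent_of_p _ _ _ hx)
          simp only
          rw [ih m s' (by omega) (by omega)]

theorem one_le_level (M : TreeMDP S T A) (s : S) : 1 ≤ M.level s := by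
  cases h : M.parent (.inner s) with
  | none =>
    have h' := (M.parent_eq_none _).1 h
    injection h' with h'
    rw [h', M.level_root]
  | some sa => have := M.level_child sa.1 sa.2 s h; omega

/-- The Bellman equation. -/
theorem value_eq [Fintype S] [Fintype T] (M : TreeMDP S T A) (π : S → A) (s : S) :
    M.value π s = ∑ x : Node S T, (M.p s (π s) x).toReal *
      (M.r s (π s) x + M.γ * match x with
        | .inner s' => M.value π s'
        | .leaf _ => 0) := by
  have h1 := M.one_le_level s
  rw [value, M.valueAux_congr π M.horizon (M.horizon + 1) s (by omega) (by omega), valueAux]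
  rfl

/-- `V(π)`, the value of the policy `π` at the starting state. -/
def V [Fintype S] [Fintype T] (M : TreeMDP S T A) (π : S → A) : ℝ := M.value π M.root

/-- Optimal policies maximise the value of each state. -/
def IsOptimal [Fintype S] [Fintype T] (M : TreeMDP S T A) (π : S → A) : Prop :=
  ∀ (π' : S → A) (s : S), M.value π' s ≤ M.value π s

/-! ### Paths and terminal returns -/

/-- Depth in the tree. -/
def depth (M : TreeMDP S T A) : Node S T → ℕ
  | .inner s => M.level s
  | .leaf _ => M.horizon + 1

theorem depth_lt (M : TreeMDP S T A) {x : Node S T} {s : S} {a : A}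
    (h : M.parent x = some (s, a)) : M.depth (.inner s) < M.depth x := by
  cases x with
  | inner s' => simp [depth, M.level_child _ _ _ h]
  | leaf σ => simpa [depth] using Nat.lt_succ_of_le (M.level_le s)

/-- The edges `(s, a, x)` on the path from the root to a node, the first edge first. -/
def path (M : TreeMDP S T A) (x : Node S T) : List (S × A × Node S T) :=
  match _h : M.parent x with
  | none => []
  | some (s, a) => M.path (.inner s) ++ [(s, a, x)]
termination_by M.depth x
decreasing_by exact M.depth_lt (by assumption)

/-- The return `ρ(σ)` along the path to `σ`; the `i`-th state on a path has level `i`. -/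
def ret (M : TreeMDP S T A) (σ : T) : ℝ :=
  ((M.path (.leaf σ)).map fun e => M.γ ^ (M.level e.1 - 1) * M.r e.1 e.2.1 e.2.2).sum

/-- `π` is consistent with `σ`: it takes the action that follows each state on the path to `σ`.
So `X(π) = {σ | M.Consistent π σ}` and `Y(σ) = {π | M.Consistent π σ}`. -/
def Consistent (M : TreeMDP S T A) (π : S → A) (σ : T) : Prop :=
  ∀ e ∈ M.path (.leaf σ), π e.1 = e.2.1

/-! ### Gaps -/

/-- The gap `Δ_π`, where `πs` is the chosen optimal policy. -/
def gap [Fintype S] [Fintype T] (M : TreeMDP S T A) (πs π : S → A) : ℝ :=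
  open Classical in
  if π = πs then M.V πs - ⨆ π' : {π' : S → A // π' ≠ πs}, M.V π'
  else M.V πs - M.V π

/-- `Δ^ε_σ`, the least clipped gap `max {Δ_π, ε}` among the policies consistent with `σ`. -/
def leafGap [Fintype S] [Fintype T] (M : TreeMDP S T A) (πs : S → A) (ε : ℝ) (σ : T) : ℝ :=
  ⨅ π : {π : S → A // M.Consistent π σ}, max (M.gap πs π) ε

/-! ### Interaction -/

/-- A list of batches of episodes. An episode is recorded as the policy that was played
and the node in which it ended (the observed trajectory is the path to that node). -/
abbrev History (S T A : Type*) := List (List ((S → A) × Node S T))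

/-- Number of episodes in a history. -/
def numEpisodes (h : History S T A) : ℕ := h.flatten.length

/-- `n(σ)`: number of episodes whose policy was consistent with `σ`. -/
def plays (M : TreeMDP S T A) (h : History S T A) (σ : T) : ℕ :=
  open Classical in h.flatten.countP fun e => decide (M.Consistent e.1 σ)

/-- `n₊(σ)`: number of episodes that reached `σ`. -/
def hits (h : History S T A) (σ : T) : ℕ :=
  open Classical in h.flatten.countP fun e : (S → A) × Node S T => decide (e.2 = .leaf σ)

/-- `n(π)`: the play count of the least played terminal state of `π`. -/
def minPlays (M : TreeMDP S T A) (h : History S T A) (π : S → A) : ℕ :=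
  ⨅ σ : {σ : T // M.Consistent π σ}, M.plays h σ

/-- The empirical value estimate of a policy. -/
def Vhat [Fintype T] (M : TreeMDP S T A) (h : History S T A) (π : S → A) : ℝ :=
  open Classical in
  ∑ σ : T with M.Consistent π σ, (hits h σ : ℝ) / (M.plays h σ : ℝ) * M.ret σ

/-- The confidence width `β(m, δ)`. -/
def beta (m : ℕ) (δ : ℝ) : ℝ := √(8 / (3 * (m : ℝ)) * Real.log (1 / δ))

/-- The mistake probability `δ_L(t)` of batch `t`, for the batch that follows the history `h`. -/
def deltaL [Fintype T] (δ : ℝ) (h : History S T A) : ℝ :=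
  δ / (3 * (Nat.card (S → A) : ℝ) * ((h.length + 1 : ℕ) : ℝ) ^ (Fintype.card T + 4))

/-- The upper confidence bound used in the batch that follows the history `h`. -/
def ucb [Fintype T] (M : TreeMDP S T A) (δ : ℝ) (h : History S T A) (π : S → A) : ℝ :=
  M.Vhat h π + beta (M.minPlays h π) (deltaL δ h)

/-- The lower confidence bound used in the batch that follows the history `h`. -/
def lcb [Fintype T] (M : TreeMDP S T A) (δ : ℝ) (h : History S T A) (π : S → A) : ℝ :=
  min (M.Vhat h π) 1 - beta (M.minPlays h π) (deltaL δ h)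

/-! ### The algorithm Lucb-T -/

/-- The choices of Lucb-T. What the algorithm leaves open (which unplayed terminal state and which
policy consistent with it is tried, and how ties of the two maximisations are broken) may depend
on the history in an arbitrary way. -/
structure LucbT [Fintype T] (M : TreeMDP S T A) (δ : ℝ) where
  /-- the policy played while some terminal state has no play -/
  explore : History S T A → S → A
  /-- a policy with the highest value estimate -/
  top : History S T A → S → A
  /-- a policy with the highest upper confidence bound among the others -/
  challenger : History S T A → S → A
  explore_spec : ∀ h, (∃ σ, M.plays h σ = 0) →
    ∃ σ, M.plays h σ = 0 ∧ M.Consistent (explore h) σ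
  top_spec : ∀ h, (∀ σ, M.plays h σ ≠ 0) → ∀ π, M.Vhat h π ≤ M.Vhat h (top h)
  challenger_ne : ∀ h, (∀ σ, M.plays h σ ≠ 0) → challenger h ≠ top h
  challenger_spec : ∀ h, (∀ σ, M.plays h σ ≠ 0) → ∀ π, π ≠ top h →
    M.ucb δ h π ≤ M.ucb δ h (challenger h)

/-- The randomness of the environment: `ω (t, i, s, a)` is the next state if action `a` is taken
from `s` in the `i`-th episode of batch `t` (batches are numbered from `0` here). -/
abbrev Sample (S T A : Type*) := ℕ × Fin 2 × S × A → Node S T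

/-- All next states are sampled independently, from `p(s, a)`. -/
def env (M : TreeMDP S T A) : Measure (Sample S T A) :=
  Measure.infinitePi fun i : ℕ × Fin 2 × S × A => (M.p i.2.2.1 i.2.2.2).toMeasure

/-- One step of an episode under `π`; terminal states are absorbing. -/
def move (π : S → A) (next : S → A → Node S T) : Node S T → Node S T
  | .inner s => next s (π s)
  | .leaf σ => .leaf σ

/-- The `i`-th episode of batch `t` if `π` is played in it, with the node in which it ends. -/
def episode (M : TreeMDP S T A) (ω : Sample S T A) (t : ℕ) (i : Fin 2) (π : S → A) :
    (S → A) × Node S T :=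
  (π, (move π fun s a => ω (t, i, s, a))^[M.horizon] (.inner M.root))

namespace LucbT

variable [Fintype T] {M : TreeMDP S T A} {δ : ℝ}

/-- Lucb-T stops after the history `h`. -/
def Stops (alg : LucbT M δ) (ε : ℝ) (h : History S T A) : Prop :=
  (∀ σ, M.plays h σ ≠ 0) ∧ M.lcb δ h (alg.top h) ≥ M.ucb δ h (alg.challenger h) - ε

/-- The episodes of the batch that follows the history `h`, if Lucb-T does not stop. -/
def batch (alg : LucbT M δ) (ω : Sample S T A) (h : History S T A) :
    List ((S → A) × Node S T) :=
  open Classical in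
  if ∃ σ, M.plays h σ = 0 then [M.episode ω h.length 0 (alg.explore h)]
  else [M.episode ω h.length 0 (alg.top h), M.episode ω h.length 1 (alg.challenger h)]

/-- The history of the first `t` batches of Lucb-T (of all batches, if it stops earlier). -/
def run (alg : LucbT M δ) (ε : ℝ) (ω : Sample S T A) : ℕ → History S T A
  | 0 => []
  | t + 1 =>
    open Classical in
    if alg.Stops ε (alg.run ε ω t) then alg.run ε ω t
    else alg.run ε ω t ++ [alg.batch ω (alg.run ε ω t)]

/-- The number of episodes before Lucb-T stops (infinite if it does not stop). -/
def episodes (alg : LucbT M δ) (ε : ℝ) (ω : Sample S T A) : ℝ≥0∞ :=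
  ⨆ t : ℕ, (numEpisodes (alg.run ε ω t) : ℝ≥0∞)

/-- The expected number of episodes before Lucb-T stops. -/
def expectedEpisodes (alg : LucbT M δ) (ε : ℝ) : ℝ≥0∞ := ∫⁻ ω, alg.episodes ε ω ∂M.env

end LucbT

end TreeMDP

end

noncomputable section

/-! The argument has three ingredients: concentration along an adaptive run, a deterministic
analysis of one batch, and a count of batches.

Concentration. The value V(π) is the sum of p(σ)ρ(σ) over the leaves σ consistent with π, where the
path probability p(σ) does not depend on π and these probabilities sum to 1 (`V_eq_sum`). Fix a
vector n of play counts and let an episode ending in σ contribute y(σ) = cρ(σ)/n(σ). Since exp y ≤ 1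
+ y + κy² and every episode uses fresh samples, the product of the compensated exponentials along
the run has mean at most 1 (`lintegral_weight_le_one`). Markov's inequality on the event that the
counts equal n controls V̂(π) − V(π) with variance proxy 1/n(π) (`env_deviation_le`). The factor |Π|
and the power of t in δ_L pay for a union bound over policies and count vectors, so the bounds of
batch t fail with probability O(1/t²) (`env_unreliable_le`).

One batch. Only a lower bound for π⋆ with one width, and upper bounds for all policies with two
widths, are needed. If these hold and the algorithm goes on, then one of the two policies played has
a width of at least a sixth of its clipped gap (`exists_le_beta`). Its least played leaf therefore
has at most a constant times log(1/δ_L)/Δ_σ² plays and receives another one.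

Counting. Up to batches with failed bounds, the number of batches is thus at most the sum over σ of
these thresholds, plus |Σ| (`length_run_le_sum`). The thresholds contain |Σ| log t, which is
absorbed by `le_of_le_log`. The bound holds for every sample, with the failed batches as an additive
term, so integrating it only needs the convergence of the sum of 1/t². -/

theorem Node.sum_eq {S T : Type*} [Fintype S] [Fintype T] (f : Node S T → ℝ) :
    ∑ x, f x = ∑ s, f (.inner s) + ∑ σ, f (.leaf σ) := by
  rw [← Equiv.sum_comp (Node.equivSum (S := S) (T := T)) f, Fintype.sum_sum_type]
  rfl

namespace TreeMDP

variable {S T A : Type*}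

/-! ### Paths and values -/

theorem path_eq_nil (M : TreeMDP S T A) {x : Node S T} (h : M.parent x = none) :
    M.path x = [] := by
  rw [path]
  split
  · rfl
  · simp_all

theorem path_eq_append (M : TreeMDP S T A) {x : Node S T} {s : S} {a : A}
    (h : M.parent x = some (s, a)) : M.path x = M.path (.inner s) ++ [(s, a, x)] := by
  rw [path]
  split
  · simp_all
  · next s' a' h' =>
    rw [h] at h'
    simp only [Option.some.injEq, Prod.mk.injEq] at h'
    obtain ⟨rfl, rfl⟩ := h'
    rfl

/-- Induction along the tree. -/
theorem node_induction (M : TreeMDP S T A) {P : Node S T → Prop}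
    (root : ∀ x, M.parent x = none → P x)
    (child : ∀ x s a, M.parent x = some (s, a) → P (.inner s) → P x) (x : Node S T) : P x := by
  induction hd : M.depth x using Nat.strong_induction_on generalizing x with
  | _ d ih =>
    cases h : M.parent x with
    | none => exact root x h
    | some sa =>
      obtain ⟨s, a⟩ := sa
      exact child x s a h (ih _ (hd ▸ M.depth_lt h) _ rfl)

theorem level_lt_of_mem_path (M : TreeMDP S T A) (x : Node S T) :
    ∀ e ∈ M.path x, M.level e.1 < M.depth x := by
  induction x using M.node_induction with
  | root x h => simp [M.path_eq_nil h]
  | child x s a h ih =>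
    have hd := M.depth_lt h
    intro e he
    rw [M.path_eq_append h, List.mem_append, List.mem_singleton] at he
    rcases he with he | rfl
    · exact (ih e he).trans hd
    · exact hd

/-- Levels strictly increase along a path. Distinct states mean distinct coordinates of the sample,
hence independent transitions. -/
theorem path_keys_nodup (M : TreeMDP S T A) (x : Node S T) :
    ((M.path x).map fun e => e.1).Nodup := by
  induction x using M.node_induction with
  | root x h => simp [M.path_eq_nil h]
  | child x s a h ih =>
    rw [M.path_eq_append h, List.map_append, List.nodup_append]
    refine ⟨ih, by simp, ?_⟩
    intro s1 h1 s2 h2 heq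
    simp only [List.map_cons, List.map_nil, List.mem_singleton] at h2
    obtain ⟨e, he, rfl⟩ := List.mem_map.1 h1
    have := M.level_lt_of_mem_path _ e he
    rw [heq, h2] at this
    exact lt_irrefl _ this

theorem parent_root (M : TreeMDP S T A) : M.parent (.inner M.root) = none :=
  (M.parent_eq_none _).2 rfl

theorem length_path_lt_depth (M : TreeMDP S T A) (x : Node S T) :
    (M.path x).length < M.depth x := by
  induction x using M.node_induction with
  | root x h =>
    rw [M.path_eq_nil h, (M.parent_eq_none x).1 h]
    simp [depth, M.level_root]
  | child x s a h ih =>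
    have hd := M.depth_lt h
    rw [M.path_eq_append h]
    simp only [List.length_append, List.length_singleton]
    omega

/-- The probability of the path to a node if the actions along it are taken. -/
def pathProb (M : TreeMDP S T A) (x : Node S T) : ℝ :=
  ((M.path x).map fun e => (M.p e.1 e.2.1 e.2.2).toReal).prod

theorem pathProb_nonneg (M : TreeMDP S T A) (x : Node S T) : 0 ≤ M.pathProb x := by
  refine List.prod_nonneg fun y hy => ?_
  obtain ⟨e, -, rfl⟩ := List.mem_map.1 hy
  exact ENNReal.toReal_nonneg

/-- `π` takes the actions on the path to a node. -/
def Visits (M : TreeMDP S T A) (π : S → A) (x : Node S T) : Prop :=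
  ∀ e ∈ M.path x, π e.1 = e.2.1

/-- The probability that an episode of `π` visits a node. -/
def mass (M : TreeMDP S T A) (π : S → A) (x : Node S T) : ℝ :=
  open Classical in if M.Visits π x then M.pathProb x else 0

theorem mass_nonneg (M : TreeMDP S T A) (π : S → A) (x : Node S T) : 0 ≤ M.mass π x := by
  rw [mass]
  split_ifs
  · exact M.pathProb_nonneg _
  · exact le_rfl

theorem mass_root (M : TreeMDP S T A) (π : S → A) : M.mass π (.inner M.root) = 1 := by
  simp [mass, Visits, pathProb, M.path_eq_nil M.parent_root]

theorem mass_child (M : TreeMDP S T A) (π : S → A) {x : Node S T} {s : S}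
    (h : M.parent x = some (s, π s)) :
    M.mass π x = M.mass π (.inner s) * (M.p s (π s) x).toReal := by
  have h1 : M.Visits π x ↔ M.Visits π (.inner s) := by
    simp only [Visits, M.path_eq_append h, List.forall_mem_append, List.forall_mem_singleton,
      and_true]
  have h2 : M.pathProb x = M.pathProb (.inner s) * (M.p s (π s) x).toReal := by
    simp [pathProb, M.path_eq_append h]
  by_cases hv : M.Visits π (.inner s)
  · rw [mass, mass, if_pos (h1.2 hv), if_pos hv, h2]
  · rw [mass, mass, if_neg (mt h1.1 hv), if_neg hv, zero_mul]

theorem mass_eq_zero (M : TreeMDP S T A) (π : S → A) {x : Node S T} {s : S} {a : A}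
    (h : M.parent x = some (s, a)) (ha : a ≠ π s) : M.mass π x = 0 := by
  rw [mass, if_neg]
  intro h'
  refine ha (h' (s, a, x) ?_).symm
  simp [M.path_eq_append h]

/-- A flow that splits at each state among the children for the chosen action ends in the
leaves. -/
theorem eq_sum_leaf [Fintype S] [Fintype T] (M : TreeMDP S T A) (π : S → A) (Φ : Node S T → ℝ)
    (h1 : ∀ s, Φ (.inner s) =
      ∑ x, open Classical in if M.parent x = some (s, π s) then Φ x else 0)
    (h2 : ∀ x s a, M.parent x = some (s, a) → a ≠ π s → Φ x = 0) :
    Φ (.inner M.root) = ∑ σ, Φ (.leaf σ) := by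
  classical
  -- Summing `h1` over all states counts each node but the root at most once, under its parent, and
  -- the uncounted ones carry no flow. The inner nodes then cancel and the root is left against the
  -- leaves.
  have key : ∑ s, Φ (.inner s) = ∑ x, (Φ x - if x = .inner M.root then Φ x else 0) := by
    rw [Finset.sum_congr rfl fun s _ => h1 s, Finset.sum_comm]
    refine Finset.sum_congr rfl fun x _ => ?_
    cases h : M.parent x with
    | none => simp [(M.parent_eq_none x).1 h]
    | some sa =>
      obtain ⟨s, a⟩ := sa
      have hx : x ≠ .inner M.root := fun hx => by simp [hx, M.parent_root] at h
      rw [if_neg hx, sub_zero]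
      by_cases ha : a = π s
      · subst ha
        rw [Finset.sum_eq_single s]
        · simp
        · intro s' _ hs'
          rw [if_neg]
          simp only [Option.some.injEq, Prod.mk.injEq, not_and]
          exact fun h => absurd h.symm hs'
        · simp
      · rw [h2 x s a h ha]
        simp
  rw [Finset.sum_sub_distrib, Node.sum_eq Φ] at key
  simp only [Finset.sum_ite_eq', Finset.mem_univ, if_true] at key
  linarith

theorem sum_p_toReal [Fintype S] [Fintype T] (M : TreeMDP S T A) (s : S) (a : A) :
    ∑ x, (M.p s a x).toReal = 1 := by
  rw [← ENNReal.toReal_sum fun x _ => (M.p s a).apply_ne_top x,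
    ← tsum_fintype (L := .unconditional _), (M.p s a).tsum_coe, ENNReal.toReal_one]

theorem sum_children [Fintype S] [Fintype T] (M : TreeMDP S T A) (π : S → A) (s : S)
    (g : Node S T → ℝ) :
    ∑ x, (open Classical in if M.parent x = some (s, π s) then M.mass π x * g x else 0) =
      M.mass π (.inner s) * ∑ x, (M.p s (π s) x).toReal * g x := by
  rw [Finset.mul_sum]
  refine Finset.sum_congr rfl fun x _ => ?_
  split_ifs with h
  · rw [M.mass_child π h, mul_assoc]
  · have : M.p s (π s) x = 0 := by
      by_contra h'
      exact h (M.parent_of_p _ _ _ h')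
    simp [this]

theorem sum_mass_leaf [Fintype S] [Fintype T] (M : TreeMDP S T A) (π : S → A) :
    ∑ σ, M.mass π (.leaf σ) = 1 := by
  rw [← M.eq_sum_leaf π (M.mass π), mass_root]
  · intro s
    have := M.sum_children π s fun _ => 1
    simp only [mul_one, M.sum_p_toReal] at this
    rw [this]
  · exact fun x s a h ha => M.mass_eq_zero π h ha

/-- The discounted rewards on the path to a node. -/
def nodeRet (M : TreeMDP S T A) (x : Node S T) : ℝ :=
  ((M.path x).map fun e => M.γ ^ (M.level e.1 - 1) * M.r e.1 e.2.1 e.2.2).sum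

/-- The discounted value of what follows a node. -/
def nodeValue [Fintype S] [Fintype T] (M : TreeMDP S T A) (π : S → A) : Node S T → ℝ
  | .inner s => M.γ ^ (M.level s - 1) * M.value π s
  | .leaf _ => 0

/-- The conserved flow is the mass times the sum of the discounted reward collected so far and the
discounted value still to come; conservation is the Bellman equation. -/
theorem V_eq_sum [Fintype S] [Fintype T] (M : TreeMDP S T A) (π : S → A) :
    M.V π = ∑ σ, M.mass π (.leaf σ) * M.ret σ := by
  have h := M.eq_sum_leaf π (fun x => M.mass π x * (M.nodeRet x + M.nodeValue π x)) ?_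
    fun x s a h ha => by simp only [M.mass_eq_zero π h ha, zero_mul]
  · simpa [mass_root, nodeRet, nodeValue, M.path_eq_nil M.parent_root, M.level_root, V, ret]
      using h
  · intro s
    rw [M.sum_children π s fun x => M.nodeRet x + M.nodeValue π x]
    congr 1
    have key : ∀ x, (M.p s (π s) x).toReal * (M.nodeRet x + M.nodeValue π x) =
        (M.p s (π s) x).toReal * M.nodeRet (.inner s) +
        M.γ ^ (M.level s - 1) * ((M.p s (π s) x).toReal *
          (M.r s (π s) x + M.γ * match x with
            | .inner s' => M.value π s'
            | .leaf _ => 0)) := by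
      intro x
      by_cases hx : M.p s (π s) x = 0
      · simp [hx]
      · have hp := M.parent_of_p _ _ _ hx
        have hr : M.nodeRet x = M.nodeRet (.inner s) + M.γ ^ (M.level s - 1) * M.r s (π s) x := by
          simp [nodeRet, M.path_eq_append hp]
        rw [hr]
        cases x with
        | leaf σ => simp only [nodeValue]; ring
        | inner s' =>
          have hl := M.level_child _ _ _ hp
          have h1 := M.one_le_level s
          have : M.γ ^ (M.level s' - 1) = M.γ ^ (M.level s - 1) * M.γ := by
            rw [← pow_succ]; congr 1; omega
          simp only [nodeValue, this]; ring
    rw [Finset.sum_congr rfl fun x _ => key x, Finset.sum_add_distrib, ← Finset.sum_mul,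
      sum_p_toReal, one_mul, ← Finset.mul_sum]
    exact congrArg _ (congrArg _ (M.value_eq π s))

theorem mass_leaf (M : TreeMDP S T A) (π : S → A) (σ : T) :
    M.mass π (.leaf σ) = open Classical in if M.Consistent π σ then M.pathProb (.leaf σ) else 0 :=
  rfl

theorem exists_consistent [Fintype S] [Fintype T] (M : TreeMDP S T A) (π : S → A) :
    ∃ σ, M.Consistent π σ := by
  by_contra! h
  have := M.sum_mass_leaf π
  simp [mass_leaf, h] at this

/-- No state repeats along a path, so the action at its last state can be set without disturbing the
earlier ones. -/
theorem exists_policy [Nonempty A] (M : TreeMDP S T A) (σ : T) : ∃ π, M.Consistent π σ := by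
  classical
  have hex : ∀ x : Node S T, ∃ π : S → A, ∀ e ∈ M.path x, π e.1 = e.2.1 := by
    intro x
    induction x using M.node_induction with
    | root x h => exact ⟨fun _ => Classical.arbitrary A, by simp [M.path_eq_nil h]⟩
    | child x s a h ih =>
      obtain ⟨π, hπ⟩ := ih
      refine ⟨Function.update π s a, fun e he => ?_⟩
      rw [M.path_eq_append h, List.mem_append, List.mem_singleton] at he
      rcases he with he | rfl
      · rw [Function.update_of_ne, hπ e he]
        rintro h'
        have := M.level_lt_of_mem_path _ e he
        rw [h'] at this
        exact lt_irrefl _ this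
      · simp
  exact hex _

theorem V_mem_Icc [Fintype S] [Fintype T] (M : TreeMDP S T A)
    (hret : ∀ σ, M.ret σ ∈ Set.Icc (0 : ℝ) 1) (π : S → A) : M.V π ∈ Set.Icc (0 : ℝ) 1 := by
  have hm : ∀ σ, 0 ≤ M.mass π (.leaf σ) := fun σ => M.mass_nonneg π _
  rw [V_eq_sum]
  refine ⟨Finset.sum_nonneg fun σ _ => mul_nonneg (hm σ) (hret σ).1, ?_⟩
  rw [← M.sum_mass_leaf π]
  exact Finset.sum_le_sum fun σ _ => mul_le_of_le_one_right (hm σ) (hret σ).2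

/-! ### The law of an episode -/

/-- Each move appends to the path the edge just sampled, so the path to the current node records
what was done and seen. -/
theorem path_iterate_move (M : TreeMDP S T A) (π : S → A) {next : S → A → Node S T}
    (hnext : ∀ s a, M.parent (next s a) = some (s, a)) (k : ℕ) :
    ∀ e ∈ M.path ((move π next)^[k] (.inner M.root)),
      π e.1 = e.2.1 ∧ next e.1 e.2.1 = e.2.2 := by
  induction k with
  | zero => simp [M.path_eq_nil M.parent_root]
  | succ k ih =>
    rw [Function.iterate_succ_apply']
    cases hx : (move π next)^[k] (.inner M.root) with
    | leaf σ => rw [hx] at ih; exact ih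
    | inner s =>
      rw [hx] at ih
      intro e he
      rw [move, M.path_eq_append (hnext s (π s)), List.mem_append, List.mem_singleton] at he
      rcases he with he | rfl
      · exact ih e he
      · exact ⟨rfl, rfl⟩

theorem iterate_move_length_path (M : TreeMDP S T A) (π : S → A) (next : S → A → Node S T)
    (x : Node S T) (hx : ∀ e ∈ M.path x, π e.1 = e.2.1 ∧ next e.1 e.2.1 = e.2.2) :
    (move π next)^[(M.path x).length] (.inner M.root) = x := by
  induction x using M.node_induction with
  | root x h =>
    rw [M.path_eq_nil h, (M.parent_eq_none x).1 h]
    rfl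
  | child x s a h ih =>
    rw [M.path_eq_append h, List.forall_mem_append, List.forall_mem_singleton] at hx
    rw [M.path_eq_append h, List.length_append, List.length_singleton,
      Function.iterate_succ_apply', ih hx.1, move, hx.2.1, hx.2.2]

theorem iterate_move_eq_leaf_iff (M : TreeMDP S T A) (π : S → A) {next : S → A → Node S T}
    (hnext : ∀ s a, M.parent (next s a) = some (s, a)) (σ : T) :
    (move π next)^[M.horizon] (.inner M.root) = .leaf σ ↔
      M.Consistent π σ ∧ ∀ e ∈ M.path (.leaf σ), next e.1 e.2.1 = e.2.2 := by
  constructor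
  · intro h
    have := M.path_iterate_move π hnext M.horizon
    rw [h] at this
    exact ⟨fun e he => (this e he).1, fun e he => (this e he).2⟩
  · rintro ⟨h1, h2⟩
    have h := M.iterate_move_length_path π next _ fun e he => ⟨h1 e he, h2 e he⟩
    -- Leaves have depth `horizon + 1`, so the path has at most `horizon` edges; the remaining moves
    -- stay at the absorbing leaf.
    have hlt := M.length_path_lt_depth (.leaf σ)
    obtain ⟨d, hd⟩ := Nat.exists_eq_add_of_le (Nat.le_of_lt_succ hlt)
    rw [hd, add_comm, Function.iterate_add_apply, h]
    exact Function.iterate_fixed rfl d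

instance (M : TreeMDP S T A) : IsProbabilityMeasure M.env := by
  unfold env; infer_instance

/-- The sample space contains transitions off the tree; they have probability zero and can be
discarded. -/
theorem ae_parent [Finite S] [Finite A] (M : TreeMDP S T A) (t : ℕ) (i : Fin 2) :
    ∀ᵐ ω ∂M.env, ∀ s a, M.parent (ω (t, i, s, a)) = some (s, a) := by
  simp only [ae_all_iff]
  intro s a
  have hmp : MeasurePreserving (Function.eval (t, i, s, a)) M.env (M.p s a).toMeasure :=
    measurePreserving_eval_infinitePi
      (fun i : ℕ × Fin 2 × S × A => (M.p i.2.2.1 i.2.2.2).toMeasure) (t, i, s, a)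
  refine hmp.quasiMeasurePreserving.ae (p := fun x => M.parent x = some (s, a)) ?_
  rw [ae_iff, PMF.toMeasure_apply_eq_zero_iff _ (MeasurableSet.of_discrete)]
  rw [Set.disjoint_left]
  intro x hx hx'
  exact hx' (M.parent_of_p s a x ((PMF.mem_support_iff _ _).1 hx))

/-- The event is a cylinder over pairwise distinct coordinates, so its probability factors. -/
theorem env_path (M : TreeMDP S T A) (t : ℕ) (i : Fin 2) (x : Node S T) :
    M.env {ω | ∀ e ∈ M.path x, ω (t, i, e.1, e.2.1) = e.2.2} = ENNReal.ofReal (M.pathProb x) := by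
  classical
  have hnd : ((M.path x).map fun e => (t, i, e.1, e.2.1)).Nodup := by
    have := M.path_keys_nodup x
    rw [List.Nodup, List.pairwise_map] at this ⊢
    exact this.imp fun h h' => h (by simpa using congrArg (fun z => z.2.2.1) h')
  have hset : {ω : Sample S T A | ∀ e ∈ M.path x, ω (t, i, e.1, e.2.1) = e.2.2} =
      Set.pi ((M.path x).map fun e => (t, i, e.1, e.2.1)).toFinset
        fun j => {y | (j.2.2.1, j.2.2.2, y) ∈ M.path x} := by
    ext ω
    simp only [Set.mem_ofPred_eq, Set.mem_pi, Finset.mem_coe, List.mem_toFinset, List.mem_map]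
    constructor
    · rintro h _ ⟨e, he, rfl⟩
      rw [h e he]
      exact he
    · intro h e he
      have h' := h _ ⟨e, he, rfl⟩
      have huniq := List.inj_on_of_nodup_map hnd h' he rfl
      exact congrArg (fun z => z.2.2) huniq
  rw [hset, env, Measure.infinitePi_pi _ fun _ _ => MeasurableSet.of_discrete,
    List.prod_toFinset _ hnd, List.map_map, pathProb]
  have hprod : ∀ l : List (S × A × Node S T),
      ENNReal.ofReal ((l.map fun e => (M.p e.1 e.2.1 e.2.2).toReal).prod) =
        (l.map fun e => M.p e.1 e.2.1 e.2.2).prod := by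
    intro l
    induction l with
    | nil => simp
    | cons e l ih =>
      rw [List.map_cons, List.map_cons, List.prod_cons, List.prod_cons,
        ENNReal.ofReal_mul ENNReal.toReal_nonneg, ih, ENNReal.ofReal_toReal (PMF.apply_ne_top _ _)]
  rw [hprod]
  congr 1
  refine List.map_congr_left fun e he => ?_
  have hsing : {y | (e.1, e.2.1, y) ∈ M.path x} = {e.2.2} := by
    ext y
    simp only [Set.mem_ofPred_eq, Set.mem_singleton_iff]
    constructor
    · intro hy
      exact congrArg (fun z => z.2.2) (List.inj_on_of_nodup_map hnd hy he rfl)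
    · rintro rfl
      exact he
  simp only [Function.comp_apply]
  rw [hsing, PMF.toMeasure_apply_singleton _ _ (MeasurableSet.of_discrete)]

/-- What is sampled for one episode. -/
def block (t : ℕ) (i : Fin 2) (ω : Sample S T A) : S × A → Node S T := fun k => ω (t, i, k.1, k.2)

theorem measurable_block (t : ℕ) (i : Fin 2) : Measurable (block (S := S) (T := T) (A := A) t i) :=
  measurable_pi_lambda _ fun _ => measurable_pi_apply _

/-- An episode in terms of what is sampled for it. -/
def outcome (M : TreeMDP S T A) (π : S → A) (y : S × A → Node S T) : (S → A) × Node S T :=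
  (π, (move π fun s a => y (s, a))^[M.horizon] (.inner M.root))

theorem episode_eq (M : TreeMDP S T A) (ω : Sample S T A) (t : ℕ) (i : Fin 2) (π : S → A) :
    M.episode ω t i π = M.outcome π (block t i ω) := rfl

theorem measurable_of_blocks [Finite S] [Finite T] [Finite A] {β : Type*} [MeasurableSpace β]
    (f : (S × A → Node S T) → β) : Measurable f := by
  have : Finite (Node S T) := Finite.of_equiv _ Node.equivSum
  exact measurable_of_finite f

theorem env_episode_leaf [Finite S] [Finite A] (M : TreeMDP S T A) (t : ℕ) (i : Fin 2)
    (π : S → A) (σ : T) :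
    M.env {ω | (M.episode ω t i π).2 = .leaf σ} = ENNReal.ofReal (M.mass π (.leaf σ)) := by
  classical
  have hae : ({ω | (M.episode ω t i π).2 = .leaf σ} : Set (Sample S T A)) =ᵐ[M.env]
      {ω | M.Consistent π σ ∧ ∀ e ∈ M.path (.leaf σ), ω (t, i, e.1, e.2.1) = e.2.2} := by
    filter_upwards [M.ae_parent t i] with ω hω
    exact propext (M.iterate_move_eq_leaf_iff π hω σ)
  rw [measure_congr hae]
  by_cases hc : M.Consistent π σ
  · simp only [hc, true_and, mass_leaf, if_true]
    exact M.env_path t i _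
  · simp [hc, mass_leaf]

/-- Averaging `hy` over the final node gives a mean of exp Y of at most 1 + D ≤ exp D, where D is
the mean of y + κy². This is the one-step supermartingale estimate. -/
theorem lintegral_exp_le_one [Fintype S] [Fintype T] [Finite A] (M : TreeMDP S T A) (t : ℕ)
    (i : Fin 2) (π : S → A) (y : T → ℝ) (κ : ℝ)
    (hy : ∀ σ, Real.exp (y σ) ≤ 1 + y σ + κ * y σ ^ 2) :
    ∫⁻ ω, ENNReal.ofReal (Real.exp
      ((match (M.episode ω t i π).2 with
        | .leaf σ => y σ
        | .inner _ => 0) -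
      ∑ σ, M.mass π (.leaf σ) * (y σ + κ * y σ ^ 2))) ∂M.env ≤ 1 := by
  have hmeas : Measurable fun ω => (M.episode ω t i π).2 :=
    (measurable_of_blocks fun y => (M.outcome π y).2).comp (measurable_block t i)
  set Y : Node S T → ℝ := fun x => match x with
    | .leaf σ => y σ
    | .inner _ => 0 with hY
  set D := ∑ σ, M.mass π (.leaf σ) * (y σ + κ * y σ ^ 2) with hD
  have hprob : IsProbabilityMeasure (M.env.map fun ω => (M.episode ω t i π).2) :=
    Measure.isProbabilityMeasure_map hmeas.aemeasurable
  set ν := M.env.map fun ω => (M.episode ω t i π).2 with hν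
  have hleaf : ∀ σ, ν.real {.leaf σ} = M.mass π (.leaf σ) := by
    intro σ
    have hm : 0 ≤ M.mass π (.leaf σ) := M.mass_nonneg π _
    rw [measureReal_def, hν, Measure.map_apply hmeas (MeasurableSet.of_discrete)]
    have := M.env_episode_leaf t i π σ
    rw [← ENNReal.toReal_ofReal hm, ← this]
    rfl
  have hY1 : ∀ x, Real.exp (Y x) ≤ 1 + (Y x + κ * Y x ^ 2) := by
    rintro (s | σ)
    · simp [hY]
    · have := hy σ
      simp only [hY]
      linarith
  have hone : ∑ x, ν.real {x} = 1 := by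
    rw [sum_measureReal_singleton]
    simp
  calc ∫⁻ ω, ENNReal.ofReal (Real.exp (Y (M.episode ω t i π).2 - D)) ∂M.env
      = ∫⁻ x, ENNReal.ofReal (Real.exp (Y x - D)) ∂ν :=
        (lintegral_map (Measurable.of_discrete (f := fun x => ENNReal.ofReal (Real.exp (Y x - D))))
          hmeas).symm
    _ = ∑ x, ENNReal.ofReal (Real.exp (Y x - D)) * ν {x} := lintegral_fintype _
    _ = ENNReal.ofReal (∑ x, Real.exp (Y x - D) * ν.real {x}) := by
        rw [ENNReal.ofReal_sum_of_nonneg fun x _ => by positivity]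
        refine Finset.sum_congr rfl fun x _ => ?_
        rw [ENNReal.ofReal_mul (by positivity), ofReal_measureReal]
    _ ≤ ENNReal.ofReal 1 := by
        refine ENNReal.ofReal_le_ofReal ?_
        have hle : ∑ x, Real.exp (Y x) * ν.real {x} ≤ 1 + D := by
          calc ∑ x, Real.exp (Y x) * ν.real {x}
              ≤ ∑ x, (ν.real {x} + (Y x + κ * Y x ^ 2) * ν.real {x}) := by
                refine Finset.sum_le_sum fun x _ => ?_
                have := mul_le_mul_of_nonneg_right (hY1 x) (measureReal_nonneg (μ := ν) (s := {x}))
                linarith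
            _ = 1 + D := by
                rw [Finset.sum_add_distrib, hone, Node.sum_eq, hD]
                simp only [hY, hleaf]
                simp [mul_comm]
        have hsum : ∑ x, Real.exp (Y x - D) * ν.real {x} =
            Real.exp (-D) * ∑ x, Real.exp (Y x) * ν.real {x} := by
          rw [Finset.mul_sum]
          refine Finset.sum_congr rfl fun x _ => ?_
          rw [sub_eq_add_neg, Real.exp_add]
          ring
        rw [hsum]
        calc Real.exp (-D) * ∑ x, Real.exp (Y x) * ν.real {x}
            ≤ Real.exp (-D) * Real.exp D := by
              refine mul_le_mul_of_nonneg_left (hle.trans ?_) (Real.exp_pos _).le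
              linarith [Real.add_one_le_exp D]
          _ = 1 := by rw [← Real.exp_add]; simp
    _ = 1 := by simp

end TreeMDP

/-- By independence the joint law is a product, so Y can be integrated out first with X frozen. Here
X will be the past and Y the fresh samples of an episode. -/
theorem lintegral_mul_le_of_indepFun {Ω U V : Type*} [MeasurableSpace Ω] [MeasurableSpace U]
    [MeasurableSpace V] {μ : Measure Ω} [IsFiniteMeasure μ] {X : Ω → U} {Y : Ω → V}
    (hX : Measurable X) (hY : Measurable Y) (h : ProbabilityTheory.IndepFun X Y μ)
    {f : U → ℝ≥0∞} {g : U → V → ℝ≥0∞} (hf : Measurable f) (hg : Measurable (Function.uncurry g))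
    (hg1 : ∀ u, ∫⁻ ω, g u (Y ω) ∂μ ≤ 1) :
    ∫⁻ ω, f (X ω) * g (X ω) (Y ω) ∂μ ≤ ∫⁻ ω, f (X ω) ∂μ := by
  have hF : Measurable fun z : U × V => f z.1 * g z.1 z.2 := (hf.comp measurable_fst).mul hg
  calc ∫⁻ ω, f (X ω) * g (X ω) (Y ω) ∂μ
      = ∫⁻ z, f z.1 * g z.1 z.2 ∂(μ.map fun ω => (X ω, Y ω)) :=
        (lintegral_map hF (hX.prodMk hY)).symm
    _ = ∫⁻ u, ∫⁻ v, f u * g u v ∂(μ.map Y) ∂(μ.map X) := by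
        rw [(ProbabilityTheory.indepFun_iff_map_prod_eq_prod_map_map hX.aemeasurable
          hY.aemeasurable).1 h, lintegral_prod _ hF.aemeasurable]
    _ ≤ ∫⁻ u, f u ∂(μ.map X) := by
        refine lintegral_mono fun u => ?_
        have hgu : Measurable (g u) := hg.comp measurable_prodMk_left
        rw [lintegral_const_mul _ hgu, lintegral_map hgu hY]
        exact mul_le_of_le_one_right' (hg1 u)
    _ = ∫⁻ ω, f (X ω) ∂μ := lintegral_map hf hX

namespace TreeMDP

variable {S T A : Type*}

/-! ### Products of weights along a run -/

/-- The product of the weights of the episodes of a history. -/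
def weight (F : (S → A) × Node S T → ℝ≥0∞) (h : History S T A) : ℝ≥0∞ :=
  (h.flatten.map F).prod

theorem weight_append (F : (S → A) × Node S T → ℝ≥0∞) (h : History S T A)
    (b : List ((S → A) × Node S T)) : weight F (h ++ [b]) = weight F h * (b.map F).prod := by
  simp [weight]

theorem block_congr {ω ω' : Sample S T A} {t : ℕ} {i : Fin 2}
    (h : ∀ s a, ω (t, i, s, a) = ω' (t, i, s, a)) : block t i ω = block t i ω' :=
  funext fun k => h k.1 k.2

/-- The weight of an episode that may not take place. -/
def optWeight (M : TreeMDP S T A) (F : (S → A) × Node S T → ℝ≥0∞) (q : Option (S → A))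
    (y : S × A → Node S T) : ℝ≥0∞ :=
  match q with
  | none => 1
  | some π => F (M.outcome π y)

theorem lintegral_optWeight_le_one {F : (S → A) × Node S T → ℝ≥0∞}
    (hF : ∀ t i π, ∫⁻ ω, F (M.episode ω t i π) ∂M.env ≤ 1) (q : Option (S → A)) (t : ℕ)
    (i : Fin 2) : ∫⁻ ω, optWeight M F q (block t i ω) ∂M.env ≤ 1 := by
  cases q with
  | none => simp [optWeight]
  | some π => exact hF t i π

/-- A sample that agrees with `u` on `I`. -/
def extend (M : TreeMDP S T A) (I : Finset (ℕ × Fin 2 × S × A)) (u : I → Node S T) :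
    Sample S T A :=
  open Classical in fun j => if h : j ∈ I then u ⟨j, h⟩ else .inner M.root

theorem extend_restrict (M : TreeMDP S T A) {I : Finset (ℕ × Fin 2 × S × A)}
    {ω : Sample S T A} {j : ℕ × Fin 2 × S × A} (h : j ∈ I) :
    extend M I (fun j => ω j) j = ω j := by
  simp [extend, h]

namespace LucbT

variable [Fintype T] {M : TreeMDP S T A} {δ : ℝ}

theorem run_succ_of_stops (alg : LucbT M δ) {ε : ℝ} {ω : Sample S T A} {t : ℕ}
    (h : alg.Stops ε (alg.run ε ω t)) : alg.run ε ω (t + 1) = alg.run ε ω t := by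
  rw [run, if_pos h]

theorem run_succ_of_not_stops (alg : LucbT M δ) {ε : ℝ} {ω : Sample S T A} {t : ℕ}
    (h : ¬ alg.Stops ε (alg.run ε ω t)) :
    alg.run ε ω (t + 1) = alg.run ε ω t ++ [alg.batch ω (alg.run ε ω t)] := by
  rw [run, if_neg h]

theorem length_run (alg : LucbT M δ) {ε : ℝ} {ω : Sample S T A} {t : ℕ}
    (h : ¬ alg.Stops ε (alg.run ε ω t)) : (alg.run ε ω t).length = t := by
  induction t with
  | zero => simp [run]
  | succ t ih =>
    by_cases h' : alg.Stops ε (alg.run ε ω t)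
    · rw [alg.run_succ_of_stops h'] at h
      exact absurd h' h
    · rw [alg.run_succ_of_not_stops h', List.length_append, List.length_singleton, ih h']

theorem batch_congr (alg : LucbT M δ) {ω ω' : Sample S T A} (h : History S T A)
    (hω : ∀ i s a, ω (h.length, i, s, a) = ω' (h.length, i, s, a)) :
    alg.batch ω h = alg.batch ω' h := by
  simp only [batch, episode_eq, block_congr (hω _)]

/-- A batch reads only the samples indexed by the length of the history, which is the batch number
while the algorithm runs. So the past depends on finitely many coordinates, disjoint from those of
the next batch. -/
theorem run_congr (alg : LucbT M δ) (ε : ℝ) {ω ω' : Sample S T A} (t : ℕ)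
    (hω : ∀ j : ℕ × Fin 2 × S × A, j.1 < t → ω j = ω' j) : alg.run ε ω t = alg.run ε ω' t := by
  induction t with
  | zero => rfl
  | succ t ih =>
    have ih := ih fun j hj => hω j (by omega)
    by_cases h : alg.Stops ε (alg.run ε ω t)
    · rw [alg.run_succ_of_stops h, alg.run_succ_of_stops (ih ▸ h), ih]
    · rw [alg.run_succ_of_not_stops h, alg.run_succ_of_not_stops (ih ▸ h), ← ih]
      congr 2
      refine alg.batch_congr _ fun i s a => hω _ ?_
      rw [alg.length_run h]
      exact Nat.lt_succ_self t

/-- The policy of the first episode after a history, if there is one. -/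
def firstPolicy (alg : LucbT M δ) (ε : ℝ) (h : History S T A) : Option (S → A) :=
  open Classical in
  if alg.Stops ε h then none
  else if ∃ σ, M.plays h σ = 0 then some (alg.explore h)
  else some (alg.top h)

/-- The policy of the second episode after a history, if there is one. -/
def secondPolicy (alg : LucbT M δ) (ε : ℝ) (h : History S T A) : Option (S → A) :=
  open Classical in
  if alg.Stops ε h then none
  else if ∃ σ, M.plays h σ = 0 then none
  else some (alg.challenger h)

/-- Counting an absent episode as a factor 1 gives every batch two factors, whether the algorithm
stops, explores or compares. -/
theorem weight_run_succ (alg : LucbT M δ) (ε : ℝ) (F : (S → A) × Node S T → ℝ≥0∞) (ω : Sample S T A)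
    (t : ℕ) : weight F (alg.run ε ω (t + 1)) =
      weight F (alg.run ε ω t) * optWeight M F (alg.firstPolicy ε (alg.run ε ω t)) (block t 0 ω) *
        optWeight M F (alg.secondPolicy ε (alg.run ε ω t)) (block t 1 ω) := by
  by_cases h : alg.Stops ε (alg.run ε ω t)
  · rw [alg.run_succ_of_stops h, firstPolicy, secondPolicy, if_pos h, if_pos h]
    simp [optWeight]
  · rw [alg.run_succ_of_not_stops h, weight_append, firstPolicy, secondPolicy, if_neg h, if_neg h,
      batch]
    simp only [alg.length_run h]
    split_ifs <;> simp [optWeight, episode_eq, mul_assoc]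

variable [Fintype S] [Fintype A]

/-- Given the past, both policies of the batch are fixed and the samples are fresh, so each factor
has conditional mean at most 1. -/
theorem lintegral_weight_succ_le (alg : LucbT M δ) (ε : ℝ) {F : (S → A) × Node S T → ℝ≥0∞}
    (hF : ∀ t i π, ∫⁻ ω, F (M.episode ω t i π) ∂M.env ≤ 1) (t : ℕ) :
    ∫⁻ ω, weight F (alg.run ε ω (t + 1)) ∂M.env ≤ ∫⁻ ω, weight F (alg.run ε ω t) ∂M.env := by
  classical
  have hfin : Finite (Node S T) := Finite.of_equiv _ Node.equivSum
  have hind : ProbabilityTheory.iIndepFun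
      (fun (j : ℕ × Fin 2 × S × A) (ω : Sample S T A) => ω j) M.env :=
    ProbabilityTheory.iIndepFun_infinitePi
      (P := fun i : ℕ × Fin 2 × S × A => (M.p i.2.2.1 i.2.2.2).toMeasure) (X := fun _ y => y)
      fun _ => measurable_id
  let P : Finset (ℕ × Fin 2 × S × A) := Finset.range t ×ˢ Finset.univ
  let B : Fin 2 → Finset (ℕ × Fin 2 × S × A) := fun i => {t} ×ˢ {i} ×ˢ Finset.univ
  have hB : ∀ (i : Fin 2) (I : Finset (ℕ × Fin 2 × S × A)), Disjoint I (B i) →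
      ProbabilityTheory.IndepFun (fun (ω : Sample S T A) (j : I) => ω j) (block t i) M.env := by
    intro i I hI
    have h := hind.indepFun_finset I (B i) hI fun j => measurable_pi_apply j
    exact h.comp (φ := id)
      (ψ := fun (u : B i → Node S T) (k : S × A) => u ⟨(t, i, k.1, k.2), by simp [B]⟩)
      measurable_id (measurable_pi_lambda _ fun k => measurable_pi_apply _)
  have step : ∀ (i : Fin 2) (I : Finset (ℕ × Fin 2 × S × A)) (f : Sample S T A → ℝ≥0∞)
      (q : Sample S T A → Option (S → A)), Disjoint I (B i) →
      (∀ ω, f (extend M I fun j => ω j) = f ω) → (∀ ω, q (extend M I fun j => ω j) = q ω) →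
      ∫⁻ ω, f ω * optWeight M F (q ω) (block t i ω) ∂M.env ≤ ∫⁻ ω, f ω ∂M.env := by
    intro i I f q hI hf hq
    have := lintegral_mul_le_of_indepFun (f := fun u => f (extend M I u))
      (g := fun u => optWeight M F (q (extend M I u)))
      (measurable_pi_lambda _ fun j => measurable_pi_apply _)
      (measurable_block t i) (hB i I hI) (measurable_of_finite _) (measurable_of_finite _)
      fun u => lintegral_optWeight_le_one hF _ t i
    simpa only [hf, hq] using this
  have hrun : ∀ (I : Finset (ℕ × Fin 2 × S × A)), P ⊆ I → ∀ ω,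
      alg.run ε (extend M I fun j => ω j) t = alg.run ε ω t := by
    intro I hI ω
    refine alg.run_congr ε t fun j hj => extend_restrict M (hI ?_)
    simp [P, hj]
  simp only [alg.weight_run_succ]
  -- The second episode is integrated out first, with the first one counted as past; then the first.
  refine (step 1 (P ∪ B 0) (fun ω => weight F (alg.run ε ω t) *
    optWeight M F (alg.firstPolicy ε (alg.run ε ω t)) (block t 0 ω))
    (fun ω => alg.secondPolicy ε (alg.run ε ω t)) ?_ ?_ ?_).trans
    (step 0 P (fun ω => weight F (alg.run ε ω t)) (fun ω => alg.firstPolicy ε (alg.run ε ω t))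
      ?_ ?_ ?_)
  · rw [Finset.disjoint_left]
    rintro ⟨t', i', k⟩ h1 h2
    simp only [P, B, Finset.mem_union, Finset.mem_product, Finset.mem_range, Finset.mem_singleton,
      Finset.mem_univ, and_true] at h1 h2
    obtain ⟨rfl, rfl⟩ := h2
    simp at h1
  · intro ω
    simp only [hrun _ Finset.subset_union_left]
    rw [block_congr (ω' := ω) fun s a => extend_restrict M (Finset.mem_union_right _ (by simp [B]))]
  · intro ω
    simp only [hrun _ Finset.subset_union_left]
  · rw [Finset.disjoint_left]
    rintro ⟨t', i', k⟩ h1 h2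
    simp only [P, B, Finset.mem_product, Finset.mem_range, Finset.mem_singleton,
      Finset.mem_univ, and_true] at h1 h2
    omega
  · intro ω
    simp only [hrun _ subset_rfl]
  · intro ω
    simp only [hrun _ subset_rfl]

/-- The history is a function of finitely many samples with finitely many values, so arbitrary
choices of the algorithm cause no measurability problem. -/
theorem measurable_run (alg : LucbT M δ) (ε : ℝ) (t : ℕ) {β : Type*} [MeasurableSpace β]
    (f : History S T A → β) : Measurable fun ω => f (alg.run ε ω t) := by
  have hfin : Finite (Node S T) := Finite.of_equiv _ Node.equivSum
  let P : Finset (ℕ × Fin 2 × S × A) := Finset.range t ×ˢ Finset.univ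
  have h : (fun ω => f (alg.run ε ω t)) =
      (fun u => f (alg.run ε (extend M P u) t)) ∘ fun ω j => ω j := by
    funext ω
    refine congrArg f (alg.run_congr ε t fun j hj => (extend_restrict M ?_).symm)
    simp [P, hj]
  rw [h]
  exact (measurable_of_finite _).comp (measurable_pi_lambda _ fun j => measurable_pi_apply _)

theorem lintegral_weight_le_one (alg : LucbT M δ) (ε : ℝ) {F : (S → A) × Node S T → ℝ≥0∞}
    (hF : ∀ t i π, ∫⁻ ω, F (M.episode ω t i π) ∂M.env ≤ 1) (t : ℕ) :
    ∫⁻ ω, weight F (alg.run ε ω t) ∂M.env ≤ 1 := by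
  induction t with
  | zero => simp [run, weight]
  | succ t ih => exact (alg.lintegral_weight_succ_le ε hF t).trans ih

end LucbT

end TreeMDP

/-! ### Quadratic upper bounds for the exponential -/

namespace Real

theorem exp_le_one_add_add_sq {y : ℝ} (hy : y ≤ 1) : exp y ≤ 1 + y + 1 * y ^ 2 := by
  rcases le_or_gt (-1) y with h | h
  · have := (abs_le.1 (Real.abs_exp_sub_one_sub_id_le (abs_le.2 ⟨h, hy⟩))).2
    linarith
  · have : exp y ≤ 1 := exp_le_one_iff.2 (by linarith)
    nlinarith

/-- Multiply by exp(−y) ≥ 1 − y + y²/2: the product of the two quadratics is 1 + y⁴/4 ≥ 1. -/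
theorem exp_le_one_add_add_half_sq {y : ℝ} (hy : y ≤ 0) : exp y ≤ 1 + y + 1 / 2 * y ^ 2 := by
  have h1 := Real.quadratic_le_exp_of_nonneg (x := -y) (by linarith)
  have h2 : exp y * exp (-y) = 1 := by rw [← exp_add]; simp
  have h3 : 0 < 1 + y + 1 / 2 * y ^ 2 := by nlinarith [sq_nonneg (y + 1)]
  by_contra! h
  have h4 : (1 + y + 1 / 2 * y ^ 2) * (1 + -y + (-y) ^ 2 / 2) < exp y * exp (-y) :=
    mul_lt_mul h h1 (by nlinarith [sq_nonneg (y - 1)]) (exp_pos y).le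
  nlinarith [sq_nonneg (y ^ 2)]

end Real

namespace TreeMDP

variable {S T A : Type*}

/-! ### Deviations of the value estimates -/

section

variable [Fintype T]

/-- All policies consistent with σ reach it with the same probability, so the compensators add up to
a multiple of `M.plays h σ` whichever policies were played. -/
theorem weight_exp (M : TreeMDP S T A) (y : T → ℝ) (κ : ℝ) (h : History S T A) :
    weight (fun e => ENNReal.ofReal (Real.exp
      ((match e.2 with
        | .leaf σ => y σ
        | .inner _ => 0) -
      ∑ σ, M.mass e.1 (.leaf σ) * (y σ + κ * y σ ^ 2)))) h =
    ENNReal.ofReal (Real.exp (∑ σ, (hits h σ * y σ -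
      M.plays h σ * M.pathProb (.leaf σ) * (y σ + κ * y σ ^ 2)))) := by
  classical
  simp only [weight, hits, plays]
  induction h.flatten with
  | nil => simp
  | cons e l ih =>
    rw [List.map_cons, List.prod_cons, ih, ← ENNReal.ofReal_mul (Real.exp_pos _).le,
      ← Real.exp_add]
    congr 2
    have h1 : (match e.2 with
        | .leaf σ => y σ
        | .inner _ => 0) = ∑ σ, if e.2 = .leaf σ then y σ else 0 := by
      cases e.2 <;> simp
    rw [h1, ← Finset.sum_sub_distrib, ← Finset.sum_add_distrib]
    refine Finset.sum_congr rfl fun σ _ => ?_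
    rw [mass_leaf]
    simp only [List.countP_cons, decide_eq_true_eq]
    split_ifs <;> push_cast <;> ring

variable [Fintype S]

/-- The exponent of `weight_exp` for weights adapted to the play counts `n`. -/
theorem le_exponent (M : TreeMDP S T A) (hret : ∀ σ, M.ret σ ∈ Set.Icc (0 : ℝ) 1) (π : S → A)
    {h : History S T A} {N : ℕ} (hN : 0 < N) (hmin : ∀ σ, M.Consistent π σ → N ≤ M.plays h σ)
    (y : T → ℝ) {c κ : ℝ} (hκ : 0 ≤ κ)
    (hy : ∀ σ, y σ = open Classical in
      if M.Consistent π σ then c * (M.ret σ / M.plays h σ) else 0) :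
    c * (M.Vhat h π - M.V π) - κ * c ^ 2 / N ≤ ∑ σ, (hits h σ * y σ -
      M.plays h σ * M.pathProb (.leaf σ) * (y σ + κ * y σ ^ 2)) := by
  classical
  have hN' : (0 : ℝ) < N := by exact_mod_cast hN
  -- The leaf masses sum to 1, so spreading the constant over the leaves reduces the claim to one
  -- leaf at a time.
  have hconst : κ * c ^ 2 / N = ∑ σ, M.mass π (.leaf σ) * (κ * c ^ 2 / N) := by
    rw [← Finset.sum_mul, sum_mass_leaf, one_mul]
  rw [hconst, V_eq_sum, Vhat, Finset.sum_filter, mul_sub, Finset.mul_sum, Finset.mul_sum,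
    ← Finset.sum_sub_distrib, ← Finset.sum_sub_distrib]
  refine Finset.sum_le_sum fun σ _ => ?_
  rw [hy, mass_leaf]
  split_ifs with hc
  · have hn : (N : ℝ) ≤ M.plays h σ := by exact_mod_cast hmin σ hc
    have hn0 : (0 : ℝ) < M.plays h σ := hN'.trans_le hn
    have hp := M.pathProb_nonneg (.leaf σ)
    have hr : M.ret σ ^ 2 ≤ 1 := pow_le_one₀ (hret σ).1 (hret σ).2
    have key : (M.plays h σ : ℝ) * M.pathProb (.leaf σ) *
        (κ * (c * (M.ret σ / M.plays h σ)) ^ 2) ≤ M.pathProb (.leaf σ) * (κ * c ^ 2 / N) := by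
      have e1 : (M.plays h σ : ℝ) * M.pathProb (.leaf σ) *
          (κ * (c * (M.ret σ / M.plays h σ)) ^ 2) =
          M.pathProb (.leaf σ) * (κ * c ^ 2 * M.ret σ ^ 2 / M.plays h σ) := by
        field_simp
      rw [e1]
      refine mul_le_mul_of_nonneg_left ?_ hp
      refine div_le_div₀ (by positivity) ?_ hN' hn
      exact mul_le_of_le_one_right (by positivity) hr
    have e2 : (M.plays h σ : ℝ) * M.pathProb (.leaf σ) * (c * (M.ret σ / M.plays h σ)) =
        c * (M.pathProb (.leaf σ) * M.ret σ) := by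
      field_simp
    have e3 : c * ((hits h σ : ℝ) / M.plays h σ * M.ret σ) =
        hits h σ * (c * (M.ret σ / M.plays h σ)) := by
      field_simp
    rw [mul_add, e2, e3]
    linarith
  · simp

end

namespace LucbT

variable [Fintype S] [Fintype T] [Fintype A] {M : TreeMDP S T A} {δ : ℝ}

/-- Markov's inequality for the product of weights. The weights must be fixed before the run, so the
counts are prescribed as `n` and the event is restricted to runs that realise them. -/
theorem env_deviation_le (alg : LucbT M δ) (ε : ℝ) (hret : ∀ σ, M.ret σ ∈ Set.Icc (0 : ℝ) 1)
    (π : S → A) (n : T → ℕ) {N : ℕ} (hN : 0 < N) (hmin : ∀ σ, M.Consistent π σ → N ≤ n σ)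
    {c κ : ℝ} (hκ : 0 ≤ κ)
    (hexp : ∀ σ, M.Consistent π σ → Real.exp (c * (M.ret σ / n σ)) ≤
      1 + c * (M.ret σ / n σ) + κ * (c * (M.ret σ / n σ)) ^ 2) (t : ℕ) (E : ℝ) :
    M.env {ω | (∀ σ, M.plays (alg.run ε ω t) σ = n σ) ∧
      E ≤ c * (M.Vhat (alg.run ε ω t) π - M.V π)} ≤
        ENNReal.ofReal (Real.exp (κ * c ^ 2 / N - E)) := by
  classical
  let y : T → ℝ := fun σ => if M.Consistent π σ then c * (M.ret σ / n σ) else 0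
  let F : (S → A) × Node S T → ℝ≥0∞ := fun e => ENNReal.ofReal (Real.exp
      ((match e.2 with
        | .leaf σ => y σ
        | .inner _ => 0) -
      ∑ σ, M.mass e.1 (.leaf σ) * (y σ + κ * y σ ^ 2)))
  have hy : ∀ σ, Real.exp (y σ) ≤ 1 + y σ + κ * y σ ^ 2 := by
    intro σ
    by_cases hc : M.Consistent π σ
    · simpa only [y, if_pos hc] using hexp σ hc
    · simp [y, hc]
  have hW := alg.lintegral_weight_le_one ε (F := F)
    (fun t i π' => M.lintegral_exp_le_one t i π' y κ hy) t
  set a := Real.exp (E - κ * c ^ 2 / N) with ha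
  have hsub : {ω | (∀ σ, M.plays (alg.run ε ω t) σ = n σ) ∧
      E ≤ c * (M.Vhat (alg.run ε ω t) π - M.V π)} ⊆
      {ω | ENNReal.ofReal a ≤ weight F (alg.run ε ω t)} := by
    rintro ω ⟨h1, h2⟩
    change ENNReal.ofReal a ≤ weight F (alg.run ε ω t)
    rw [M.weight_exp y κ]
    refine ENNReal.ofReal_le_ofReal (Real.exp_le_exp.2 ?_)
    refine le_trans ?_ (M.le_exponent hret π (h := alg.run ε ω t) hN
      (fun σ hc => (h1 σ).symm ▸ hmin σ hc) y (c := c) hκ fun σ => by simp only [y, h1])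
    linarith
  have ha0 : ENNReal.ofReal a ≠ 0 := by simp [ha, Real.exp_pos]
  calc _ ≤ _ := measure_mono hsub
    _ ≤ (∫⁻ ω, weight F (alg.run ε ω t) ∂M.env) / ENNReal.ofReal a :=
      meas_ge_le_lintegral_div (alg.measurable_run ε t _).aemeasurable ha0 ENNReal.ofReal_ne_top
    _ ≤ 1 / ENNReal.ofReal a := ENNReal.div_le_div_right hW _
    _ = ENNReal.ofReal (Real.exp (κ * c ^ 2 / N - E)) := by
      rw [one_div, ← ENNReal.ofReal_inv_of_pos (Real.exp_pos _), ← Real.exp_neg, neg_sub]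

end LucbT

/-- The logarithm of `1 / δ_L` in the batch that follows `t` batches. -/
def confLog (S T A : Type*) [Fintype T] (δ : ℝ) (t : ℕ) : ℝ :=
  Real.log (1 / (δ / (3 * (Nat.card (S → A) : ℝ) * ((t + 1 : ℕ) : ℝ) ^ (Fintype.card T + 4))))

theorem confLog_eq (S T A : Type*) [Fintype S] [Fintype T] [Fintype A] [Nonempty A] {δ : ℝ}
    (hδ : 0 < δ) (t : ℕ) : confLog S T A δ t =
      Real.log 3 + Fintype.card S * Real.log (Fintype.card A) + Real.log (1 / δ) +
        (Fintype.card T + 4) * Real.log ((t + 1 : ℕ) : ℝ) := by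
  classical
  have hA : (0 : ℝ) < Fintype.card A := by exact_mod_cast Fintype.card_pos
  have ht : (0 : ℝ) < ((t + 1 : ℕ) : ℝ) := by positivity
  have hcard : (Nat.card (S → A) : ℝ) = (Fintype.card A : ℝ) ^ Fintype.card S := by
    rw [Nat.card_eq_fintype_card, Fintype.card_fun]; push_cast; rfl
  rw [confLog, hcard, one_div_div, div_eq_mul_one_div, Real.log_mul (by positivity) (by positivity),
    Real.log_mul (by positivity) (by positivity), Real.log_mul (by positivity) (by positivity),
    Real.log_pow, Real.log_pow]
  push_cast
  ring

theorem confLog_nonneg (S T A : Type*) [Fintype S] [Fintype T] [Fintype A] [Nonempty A] {δ : ℝ}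
    (hδ : δ ∈ Set.Ioo (0 : ℝ) 1) (t : ℕ) : 0 ≤ confLog S T A δ t := by
  rw [confLog_eq S T A hδ.1]
  have h1 : 0 ≤ Real.log (1 / δ) := Real.log_nonneg (one_le_one_div hδ.1 hδ.2.le)
  have h2 := Real.log_natCast_nonneg (Fintype.card A)
  have h3 := Real.log_natCast_nonneg (t + 1)
  have h4 := Real.log_nonneg (show (1 : ℝ) ≤ 3 by norm_num)
  positivity

theorem log_deltaL [Fintype T] (δ : ℝ) (h : History S T A) :
    Real.log (1 / deltaL δ h) = confLog S T A δ h.length := rfl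

theorem mul_beta_sq {m : ℕ} (hm : 0 < m) {δ : ℝ} (hδ : 0 ≤ Real.log (1 / δ)) :
    (m : ℝ) * beta m δ ^ 2 = 8 / 3 * Real.log (1 / δ) := by
  have hm' : (0 : ℝ) < m := by exact_mod_cast hm
  rw [beta, Real.sq_sqrt (by positivity)]
  field_simp

/-- The confidence bounds are good enough for the analysis of a batch. -/
def Reliable [Fintype S] [Fintype T] (M : TreeMDP S T A) (δ : ℝ) (πs : S → A)
    (h : History S T A) : Prop :=
  M.V πs ≤ M.ucb δ h πs ∧ ∀ π, beta (M.minPlays h π) (deltaL δ h) ≤ 1 →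
    M.Vhat h π ≤ M.V π + 2 * beta (M.minPlays h π) (deltaL δ h)

theorem exists_minPlays_eq [Fintype S] [Fintype T] (M : TreeMDP S T A) (h : History S T A)
    (π : S → A) : ∃ σ, M.Consistent π σ ∧ M.minPlays h π = M.plays h σ := by
  obtain ⟨σ, hσ⟩ := M.exists_consistent π
  have : Nonempty {σ : T // M.Consistent π σ} := ⟨⟨σ, hσ⟩⟩
  obtain ⟨⟨σ', hσ'⟩, h'⟩ :=
    exists_eq_ciInf_of_finite (f := fun σ : {σ : T // M.Consistent π σ} => M.plays h σ)
  exact ⟨σ', hσ', h'.symm⟩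

/-- Once counts and length are prescribed the width is deterministic, and can be used to choose the
Chernoff parameter. -/
theorem exists_beta_eq [Fintype S] [Fintype T] [Fintype A] [Nonempty A] (M : TreeMDP S T A)
    {δ : ℝ} (hδ : δ ∈ Set.Ioo (0 : ℝ) 1) (π : S → A) (n : T → ℕ) (hn : ∀ σ, 0 < n σ) (t : ℕ) :
    ∃ N : ℕ, 0 < N ∧ (∀ σ, M.Consistent π σ → N ≤ n σ) ∧ ∃ b : ℝ, 0 ≤ b ∧
      N * b ^ 2 = 8 / 3 * confLog S T A δ t ∧
      ∀ h : History S T A, (∀ σ, M.plays h σ = n σ) → h.length = t →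
        beta (M.minPlays h π) (deltaL δ h) = b := by
  obtain ⟨σ, hσ⟩ := M.exists_consistent π
  have : Nonempty {σ : T // M.Consistent π σ} := ⟨⟨σ, hσ⟩⟩
  obtain ⟨⟨σ', hσ'⟩, h'⟩ :=
    exists_eq_ciInf_of_finite (f := fun σ : {σ : T // M.Consistent π σ} => n σ)
  refine ⟨n σ', hn σ', fun σ hσ => ?_, beta (n σ')
    (δ / (3 * (Nat.card (S → A) : ℝ) * ((t + 1 : ℕ) : ℝ) ^ (Fintype.card T + 4))),
    Real.sqrt_nonneg _, mul_beta_sq (hn σ') (confLog_nonneg S T A hδ t), ?_⟩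
  · rw [h']
    exact ciInf_le (Finite.bddBelow_range fun σ : {σ : T // M.Consistent π σ} => n σ) ⟨σ, hσ⟩
  · intro h hh ht
    simp only at h'
    simp only [minPlays, hh, deltaL, ht, h']

/-! ### Probability that the confidence bounds fail -/

namespace LucbT

variable [Fintype S] [Fintype T] [Fintype A] {M : TreeMDP S T A} {δ : ℝ}

section

variable [Nonempty A]

/-- For the lower tail y ≤ 0, so κ = 1/2 is allowed. The optimal c = −Nb gives the exponent −Nb²/2,
which is −4/3 times the logarithm. -/
theorem env_low_le (alg : LucbT M δ) (ε : ℝ) (hret : ∀ σ, M.ret σ ∈ Set.Icc (0 : ℝ) 1)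
    (hδ : δ ∈ Set.Ioo (0 : ℝ) 1) (π : S → A) (n : T → ℕ) (hn : ∀ σ, 0 < n σ) (t : ℕ) :
    M.env {ω | (∀ σ, M.plays (alg.run ε ω t) σ = n σ) ∧ (alg.run ε ω t).length = t ∧
      M.ucb δ (alg.run ε ω t) π < M.V π} ≤
        ENNReal.ofReal (Real.exp (-(4 / 3) * confLog S T A δ t)) := by
  obtain ⟨N, hpos, hmin, b, hb0, hb2, hb⟩ := M.exists_beta_eq hδ π n hn t
  have hNr : (0 : ℝ) < N := by exact_mod_cast hpos
  refine le_trans (measure_mono ?_) ((alg.env_deviation_le ε hret π n hpos hmin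
    (c := -(N * b)) (κ := 1 / 2) (by norm_num) ?_ t (N * b ^ 2)).trans (le_of_eq ?_))
  · rintro ω ⟨h1, h2, h3⟩
    refine ⟨h1, ?_⟩
    rw [ucb, hb _ h1 h2] at h3
    have : b ≤ -(M.Vhat (alg.run ε ω t) π - M.V π) := by linarith
    have := mul_le_mul_of_nonneg_left this (mul_nonneg hNr.le hb0)
    nlinarith
  · intro σ _
    refine Real.exp_le_one_add_add_half_sq ?_
    have : 0 ≤ M.ret σ / n σ := div_nonneg (hret σ).1 (by positivity)
    have := mul_nonneg (mul_nonneg hNr.le hb0) this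
    linarith
  · congr 2
    have : 1 / 2 * (-(N * b)) ^ 2 / N = 1 / 2 * (N * b ^ 2) := by field_simp
    rw [this, hb2]
    ring

/-- For the upper tail κ = 1 needs y ≤ 1; with c = Nb one has y ≤ b, whence the restriction to
widths at most 1. A deviation of 2b gives the exponent −Nb². -/
theorem env_high_le (alg : LucbT M δ) (ε : ℝ) (hret : ∀ σ, M.ret σ ∈ Set.Icc (0 : ℝ) 1)
    (hδ : δ ∈ Set.Ioo (0 : ℝ) 1) (π : S → A) (n : T → ℕ) (hn : ∀ σ, 0 < n σ) (t : ℕ) :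
    M.env {ω | (∀ σ, M.plays (alg.run ε ω t) σ = n σ) ∧ (alg.run ε ω t).length = t ∧
      beta (M.minPlays (alg.run ε ω t) π) (deltaL δ (alg.run ε ω t)) ≤ 1 ∧
      M.V π + 2 * beta (M.minPlays (alg.run ε ω t) π) (deltaL δ (alg.run ε ω t)) <
        M.Vhat (alg.run ε ω t) π} ≤
        ENNReal.ofReal (Real.exp (-(8 / 3) * confLog S T A δ t)) := by
  obtain ⟨N, hpos, hmin, b, hb0, hb2, hb⟩ := M.exists_beta_eq hδ π n hn t
  have hNr : (0 : ℝ) < N := by exact_mod_cast hpos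
  rcases lt_or_ge 1 b with hb1 | hb1
  · refine (measure_mono_null ?_ measure_empty).le.trans zero_le
    rintro ω ⟨h1, h2, h3, -⟩
    rw [hb _ h1 h2] at h3
    exact absurd h3 (not_le.2 hb1)
  refine le_trans (measure_mono ?_) ((alg.env_deviation_le ε hret π n hpos hmin
    (c := N * b) (κ := 1) (by norm_num) ?_ t (2 * (N * b ^ 2))).trans (le_of_eq ?_))
  · rintro ω ⟨h1, h2, -, h3⟩
    refine ⟨h1, ?_⟩
    rw [hb _ h1 h2] at h3
    have : 2 * b ≤ M.Vhat (alg.run ε ω t) π - M.V π := by linarith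
    have := mul_le_mul_of_nonneg_left this (mul_nonneg hNr.le hb0)
    nlinarith
  · intro σ hσ
    refine Real.exp_le_one_add_add_sq ?_
    have hnσ : (N : ℝ) ≤ n σ := by exact_mod_cast hmin σ hσ
    have h1 : N * (M.ret σ / n σ) ≤ 1 := by
      rw [mul_div_assoc', div_le_one (hNr.trans_le hnσ)]
      exact (mul_le_of_le_one_right hNr.le (hret σ).2).trans hnσ
    have h2 : 0 ≤ N * (M.ret σ / n σ) :=
      mul_nonneg hNr.le (div_nonneg (hret σ).1 (by positivity))
    calc N * b * (M.ret σ / n σ) = N * (M.ret σ / n σ) * b := by ring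
      _ ≤ 1 := mul_le_one₀ h1 hb0 hb1
  · congr 2
    have : 1 * (N * b) ^ 2 / N = N * b ^ 2 := by field_simp
    rw [this, hb2]
    ring

end

end LucbT

theorem numEpisodes_append (h : History S T A) (b : List ((S → A) × Node S T)) :
    numEpisodes (h ++ [b]) = numEpisodes h + b.length := by
  simp [numEpisodes]

theorem plays_le_numEpisodes (M : TreeMDP S T A) (h : History S T A) (σ : T) :
    M.plays h σ ≤ numEpisodes h := List.countP_le_length

theorem numEpisodes_run_le [Fintype T] {M : TreeMDP S T A} {δ : ℝ} (alg : LucbT M δ) (ε : ℝ)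
    (ω : Sample S T A) (t : ℕ) :
    numEpisodes (alg.run ε ω t) ≤ 2 * (alg.run ε ω t).length := by
  induction t with
  | zero => simp [LucbT.run, numEpisodes]
  | succ t ih =>
    by_cases h : alg.Stops ε (alg.run ε ω t)
    · rwa [alg.run_succ_of_stops h]
    · rw [alg.run_succ_of_not_stops h, numEpisodes_append, List.length_append,
        List.length_singleton]
      have : (alg.batch ω (alg.run ε ω t)).length ≤ 2 := by
        rw [LucbT.batch]; split_ifs <;> simp
      omega

/-- From t + 1 ≥ 8 on, log 2 ≤ log(t + 1)/3, so the count vectors cost at most 4/3 · |Σ| log(t + 1).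
The term |Σ| log(t + 1) in the logarithm pays for this, and the extra 4 log(t + 1) leaves the
inverse square. -/
theorem card_mul_exp_confLog_le (S T A : Type*) [Fintype S] [Fintype T] [Fintype A] [Nonempty A]
    {δ : ℝ} (hδ : δ ∈ Set.Ioo (0 : ℝ) 1) {t : ℕ} (ht : 7 ≤ t) :
    (2 * ((t + 1 : ℕ) : ℝ)) ^ Fintype.card T * (Real.exp (-(4 / 3) * confLog S T A δ t) +
      (Fintype.card A : ℝ) ^ Fintype.card S * Real.exp (-(8 / 3) * confLog S T A δ t)) ≤
        2 / ((t + 1 : ℕ) : ℝ) ^ 2 := by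
  have hA : (0 : ℝ) < Fintype.card A := by exact_mod_cast Fintype.card_pos
  have hτ : (0 : ℝ) < ((t + 1 : ℕ) : ℝ) := by positivity
  have h8 : (8 : ℝ) ≤ ((t + 1 : ℕ) : ℝ) := by exact_mod_cast Nat.succ_le_succ ht
  set ℓ := Real.log ((t + 1 : ℕ) : ℝ) with hℓ
  set P := Fintype.card S * Real.log (Fintype.card A) with hP
  have hP0 : 0 ≤ P := mul_nonneg (Nat.cast_nonneg _) (Real.log_natCast_nonneg _)
  have hℓ2 : 3 * Real.log 2 ≤ ℓ := by
    have : Real.log 8 = 3 * Real.log 2 := by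
      rw [show (8 : ℝ) = 2 ^ 3 by norm_num, Real.log_pow]; norm_num
    rw [← this]
    exact Real.log_le_log (by norm_num) h8
  have hℓ0 : 0 ≤ ℓ := by linarith [Real.log_nonneg (show (1 : ℝ) ≤ 2 by norm_num)]
  have hL : P + (Fintype.card T + 4) * ℓ ≤ confLog S T A δ t := by
    rw [confLog_eq S T A hδ.1]
    have h1 : 0 ≤ Real.log (1 / δ) := Real.log_nonneg (one_le_one_div hδ.1 hδ.2.le)
    have h4 := Real.log_nonneg (show (1 : ℝ) ≤ 3 by norm_num)
    linarith
  have e1 : (2 * ((t + 1 : ℕ) : ℝ)) ^ Fintype.card T =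
      Real.exp (Fintype.card T * (Real.log 2 + ℓ)) := by
    rw [← Real.log_mul (by norm_num) hτ.ne', ← Real.log_pow, Real.exp_log (by positivity)]
  have e2 : (Fintype.card A : ℝ) ^ Fintype.card S = Real.exp P := by
    rw [hP, ← Real.log_pow, Real.exp_log (by positivity)]
  have e3 : 1 / ((t + 1 : ℕ) : ℝ) ^ 2 = Real.exp (-(2 * ℓ)) := by
    rw [Real.exp_neg, two_mul, Real.exp_add, Real.exp_log hτ, one_div, sq]
  have hT : (0 : ℝ) ≤ Fintype.card T := Nat.cast_nonneg _
  have hm := mul_le_mul_of_nonneg_left hℓ2 hT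
  have hTl := mul_nonneg hT hℓ0
  rw [show 2 / ((t + 1 : ℕ) : ℝ) ^ 2 =
      1 / ((t + 1 : ℕ) : ℝ) ^ 2 + 1 / ((t + 1 : ℕ) : ℝ) ^ 2 by ring,
    e1, e2, e3, mul_add, ← Real.exp_add, ← Real.exp_add, ← Real.exp_add]
  refine add_le_add (Real.exp_le_exp.2 ?_) (Real.exp_le_exp.2 ?_) <;> nlinarith

namespace LucbT

variable [Fintype S] [Fintype T] [Fintype A] [Nonempty A] {M : TreeMDP S T A} {δ : ℝ}

theorem env_unreliable_le (alg : LucbT M δ) (ε : ℝ) (hret : ∀ σ, M.ret σ ∈ Set.Icc (0 : ℝ) 1)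
    (hδ : δ ∈ Set.Ioo (0 : ℝ) 1) (πs : S → A) (t : ℕ) :
    M.env {ω | (alg.run ε ω t).length = t ∧ (∀ σ, M.plays (alg.run ε ω t) σ ≠ 0) ∧
      ¬ M.Reliable δ πs (alg.run ε ω t)} ≤ ENNReal.ofReal (64 / ((t + 1 : ℕ) : ℝ) ^ 2) := by
  classical
  -- For t + 1 ≤ 8 the claimed bound is at least 1; this is the origin of 64.
  rcases lt_or_ge t 7 with ht | ht
  · refine prob_le_one.trans ?_
    rw [← ENNReal.ofReal_one]
    refine ENNReal.ofReal_le_ofReal ?_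
    have h8 : ((t + 1 : ℕ) : ℝ) ≤ 8 := by exact_mod_cast (by omega : t + 1 ≤ 8)
    rw [le_div_iff₀ (by positivity), one_mul]
    nlinarith [show (0 : ℝ) ≤ ((t + 1 : ℕ) : ℝ) from Nat.cast_nonneg _]
  set a := Real.exp (-(4 / 3) * confLog S T A δ t) with ha
  set b := Real.exp (-(8 / 3) * confLog S T A δ t) with hb
  have ha0 : 0 ≤ a := (Real.exp_pos _).le
  have hb0 : 0 ≤ b := (Real.exp_pos _).le
  -- The possible count vectors: each batch has at most two episodes.
  let I : Finset (T → ℕ) := Fintype.piFinset fun _ => Finset.Icc 1 (2 * t)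
  let low : (T → ℕ) → Set (Sample S T A) := fun n =>
    {ω | (∀ σ, M.plays (alg.run ε ω t) σ = n σ) ∧ (alg.run ε ω t).length = t ∧
      M.ucb δ (alg.run ε ω t) πs < M.V πs}
  let high : (T → ℕ) → (S → A) → Set (Sample S T A) := fun n π =>
    {ω | (∀ σ, M.plays (alg.run ε ω t) σ = n σ) ∧ (alg.run ε ω t).length = t ∧
      beta (M.minPlays (alg.run ε ω t) π) (deltaL δ (alg.run ε ω t)) ≤ 1 ∧
      M.V π + 2 * beta (M.minPlays (alg.run ε ω t) π) (deltaL δ (alg.run ε ω t)) <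
        M.Vhat (alg.run ε ω t) π}
  have hsub : {ω | (alg.run ε ω t).length = t ∧ (∀ σ, M.plays (alg.run ε ω t) σ ≠ 0) ∧
      ¬ M.Reliable δ πs (alg.run ε ω t)} ⊆ ⋃ n ∈ I, (low n ∪ ⋃ π, high n π) := by
    rintro ω ⟨h1, h2, h3⟩
    simp only [Set.mem_iUnion, Set.mem_union, exists_prop]
    refine ⟨fun σ => M.plays (alg.run ε ω t) σ, ?_, ?_⟩
    · simp only [I, Fintype.mem_piFinset, Finset.mem_Icc]
      intro σ
      have := M.plays_le_numEpisodes (alg.run ε ω t) σ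
      have := numEpisodes_run_le alg ε ω t
      have := h2 σ
      omega
    · rw [Reliable, not_and_or] at h3
      rcases h3 with h3 | h3
      · exact Or.inl ⟨fun _ => rfl, h1, not_le.1 h3⟩
      · push Not at h3
        obtain ⟨π, h3, h4⟩ := h3
        exact Or.inr ⟨π, fun _ => rfl, h1, h3, h4⟩
  have hcard : (I.card : ℝ) ≤ (2 * ((t + 1 : ℕ) : ℝ)) ^ Fintype.card T := by
    simp only [I, Fintype.card_piFinset, Nat.card_Icc, Finset.prod_const, Finset.card_univ,
      add_tsub_cancel_right]
    push_cast
    gcongr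
    linarith
  calc M.env {ω | (alg.run ε ω t).length = t ∧ (∀ σ, M.plays (alg.run ε ω t) σ ≠ 0) ∧
      ¬ M.Reliable δ πs (alg.run ε ω t)}
      ≤ ∑ n ∈ I, M.env (low n ∪ ⋃ π, high n π) :=
        (measure_mono hsub).trans (measure_biUnion_finset_le _ _)
    _ ≤ ∑ n ∈ I, ENNReal.ofReal (a + (Fintype.card A : ℝ) ^ Fintype.card S * b) := by
        refine Finset.sum_le_sum fun n hn => ?_
        have hn' : ∀ σ, 0 < n σ := fun σ =>
          (Finset.mem_Icc.1 (Fintype.mem_piFinset.1 hn σ)).1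
        rw [ENNReal.ofReal_add ha0 (by positivity)]
        refine (measure_union_le _ _).trans
          (add_le_add (alg.env_low_le ε hret hδ πs n hn' t) ?_)
        calc M.env (⋃ π, high n π) ≤ ∑ π, M.env (high n π) := measure_iUnion_fintype_le _ _
          _ ≤ ∑ _π : S → A, ENNReal.ofReal b :=
            Finset.sum_le_sum fun π _ => alg.env_high_le ε hret hδ π n hn' t
          _ = ENNReal.ofReal ((Fintype.card A : ℝ) ^ Fintype.card S * b) := by
            rw [Finset.sum_const, Finset.card_univ, Fintype.card_fun, nsmul_eq_mul,
              ENNReal.ofReal_mul (by positivity), ENNReal.ofReal_pow (by positivity)]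
            simp
    _ = ENNReal.ofReal (I.card * (a + (Fintype.card A : ℝ) ^ Fintype.card S * b)) := by
        rw [Finset.sum_const, nsmul_eq_mul, ENNReal.ofReal_mul (by positivity)]
        simp
    _ ≤ ENNReal.ofReal (64 / ((t + 1 : ℕ) : ℝ) ^ 2) := by
        refine ENNReal.ofReal_le_ofReal ?_
        calc (I.card : ℝ) * (a + (Fintype.card A : ℝ) ^ Fintype.card S * b)
            ≤ (2 * ((t + 1 : ℕ) : ℝ)) ^ Fintype.card T *
              (a + (Fintype.card A : ℝ) ^ Fintype.card S * b) := by gcongr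
          _ ≤ 2 / ((t + 1 : ℕ) : ℝ) ^ 2 := card_mul_exp_confLog_le S T A hδ ht
          _ ≤ 64 / ((t + 1 : ℕ) : ℝ) ^ 2 := by gcongr; norm_num

end LucbT

/-! ### Gaps -/

section Gap

variable [Fintype S] [Fintype T] (M : TreeMDP S T A) {πs : S → A}

theorem gap_of_ne {π : S → A} (h : π ≠ πs) : M.gap πs π = M.V πs - M.V π := if_neg h

/-- This lets a small width of the policy `πs` be measured against the gap of the policy it is
compared with. -/
theorem gap_self_le [Finite A] {π : S → A} (h : π ≠ πs) : M.gap πs πs ≤ M.gap πs π := by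
  rw [M.gap_of_ne h, gap, if_pos rfl]
  have := le_ciSup (Finite.bddAbove_range fun π' : {π' : S → A // π' ≠ πs} => M.V π') ⟨π, h⟩
  simp only at this
  linarith

theorem gap_le_one [Finite A] [Nontrivial A] (hret : ∀ σ, M.ret σ ∈ Set.Icc (0 : ℝ) 1)
    (π : S → A) : M.gap πs π ≤ 1 := by
  have h : ∀ π ≠ πs, M.gap πs π ≤ 1 := fun π h => by
    rw [M.gap_of_ne h]
    linarith [(M.V_mem_Icc hret πs).2, (M.V_mem_Icc hret π).1]
  by_cases hπ : π = πs
  · subst hπ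
    have : Nonempty S := ⟨M.root⟩
    obtain ⟨π', hπ'⟩ := exists_ne π
    exact (M.gap_self_le hπ').trans (h π' hπ')
  · exact h π hπ

variable {ε : ℝ}

theorem leafGap_le [Finite A] {π : S → A} {σ : T} (h : M.Consistent π σ) :
    M.leafGap πs ε σ ≤ max (M.gap πs π) ε :=
  ciInf_le (Finite.bddBelow_range fun π : {π : S → A // M.Consistent π σ} =>
    max (M.gap πs π) ε) ⟨π, h⟩

theorem leafGap_pos [Nonempty A] (hε : 0 < ε) (σ : T) : 0 < M.leafGap πs ε σ := by
  obtain ⟨π, hπ⟩ := M.exists_policy σ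
  have : Nonempty {π : S → A // M.Consistent π σ} := ⟨⟨π, hπ⟩⟩
  exact hε.trans_le (le_ciInf fun π => le_max_right _ _)

theorem leafGap_le_one [Finite A] [Nontrivial A] (hret : ∀ σ, M.ret σ ∈ Set.Icc (0 : ℝ) 1)
    (hε : ε ≤ 1) (σ : T) :
    M.leafGap πs ε σ ≤ 1 := by
  obtain ⟨π, hπ⟩ := M.exists_policy σ
  exact (M.leafGap_le hπ).trans (max_le (M.gap_le_one hret π) hε)

/-- If a batch is played with good confidence bounds, then one of its policies is
underexplored. -/
theorem exists_le_beta [Finite A] [Nontrivial A] {δ : ℝ} (hret : ∀ σ, M.ret σ ∈ Set.Icc (0 : ℝ) 1)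
    (hε : ε ∈ Set.Ioo (0 : ℝ) 1) (alg : LucbT M δ)
    {h : History S T A} (hplays : ∀ σ, M.plays h σ ≠ 0) (hrun : ¬ alg.Stops ε h)
    (hrel : M.Reliable δ πs h) :
    ∃ π, (π = alg.top h ∨ π = alg.challenger h) ∧
      max (M.gap πs π) ε / 6 ≤ beta (M.minPlays h π) (deltaL δ h) := by
  by_contra! hcon
  have h1 := hcon _ (Or.inl rfl)
  have h2 := hcon _ (Or.inr rfl)
  have htop := alg.top_spec h hplays
  have hne := alg.challenger_ne h hplays
  have hch := alg.challenger_spec h hplays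
  have hns : M.lcb δ h (alg.top h) < M.ucb δ h (alg.challenger h) - ε := by
    by_contra! h'
    exact hrun ⟨hplays, h'⟩
  have hV1 := fun π => (M.V_mem_Icc hret π).2
  -- Clipped gaps are at most 1, so both widths are below 1/6 and the upper bounds in `Reliable`
  -- apply.
  have hmax : ∀ π, max (M.gap πs π) ε ≤ 1 := fun π => max_le (M.gap_le_one hret π) hε.2.le
  have hup1 := hrel.2 (alg.top h) (by linarith [hmax (alg.top h)])
  have hup2 := hrel.2 (alg.challenger h) (by linarith [hmax (alg.challenger h)])
  have hlow := hrel.1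
  have hb0 : ∀ π, 0 ≤ beta (M.minPlays h π) (deltaL δ h) := fun π => Real.sqrt_nonneg _
  have hb1 := hb0 (alg.top h)
  have hb2 := hb0 (alg.challenger h)
  have hVle := htop (alg.challenger h)
  simp only [lcb, ucb] at hns hlow hch
  -- If V̂ of the top policy exceeds 1, the cap in `lcb` costs two further widths, through V̂ ≤ V +
  -- 2β ≤ 1 + 2β for the challenger. This rules out that both widths are below ε/6.
  have hwide : ε < beta (M.minPlays h (alg.top h)) (deltaL δ h) +
      3 * beta (M.minPlays h (alg.challenger h)) (deltaL δ h) := by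
    rcases min_choice (M.Vhat h (alg.top h)) 1 with hm | hm <;> rw [hm] at hns
    · linarith
    · linarith [hV1 (alg.challenger h)]
  have hε0 := hε.1
  by_cases hs1 : alg.top h = πs
  · have hs2 : alg.challenger h ≠ πs := hs1 ▸ hne
    have hg := M.gap_self_le hs2
    rw [hs1] at h1 hns hwide hb1
    -- The cap at 1 keeps this a valid lower bound. Not stopping then gives Δ + ε < 2β₁ + 3β₂ for
    -- the challenger's gap Δ, impossible with both widths below Δ/6.
    have hl : M.V πs - beta (M.minPlays h πs) (deltaL δ h) ≤ min (M.Vhat h πs) 1 :=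
      le_min (by linarith) (by linarith [hV1 πs, hb0 πs])
    have h1' := h1.trans_le (div_le_div_of_nonneg_right (max_le_max_right ε hg) (by norm_num))
    rw [M.gap_of_ne hs2] at h1' h2
    rcases max_cases (M.V πs - M.V (alg.challenger h)) ε with ⟨hm, hm'⟩ | ⟨hm, hm'⟩ <;>
      rw [hm] at h1' h2 <;> linarith
  · have hopt := hch πs (Ne.symm hs1)
    have hg := M.gap_self_le hs1
    by_cases hs2 : alg.challenger h = πs
    -- Here V(π⋆) − β₂ ≤ V̂(π⋆) ≤ V̂(π₁) ≤ V(π₁) + 2β₁, so the gap of π₁ is at most 2β₁ + β₂.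
    · rw [hs2] at h2 hup2 hb2 hVle hwide hns
      have h2' := h2.trans_le (div_le_div_of_nonneg_right (max_le_max_right ε hg) (by norm_num))
      rw [M.gap_of_ne hs1] at h1 h2'
      rcases max_cases (M.V πs - M.V (alg.top h)) ε with ⟨hm, hm'⟩ | ⟨hm, hm'⟩ <;>
        rw [hm] at h1 h2' <;> linarith
    -- Comparing `ucb` of π⋆ and π₂ gives Δ₂ ≤ 3β₂, which forces Δ₂ < ε; then Δ₁ ≤ 2β₁ + β₂ forces
    -- Δ₁ < ε, and `hwide` concludes.
    · rw [M.gap_of_ne hs1] at h1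
      rw [M.gap_of_ne hs2] at h2
      rcases max_cases (M.V πs - M.V (alg.top h)) ε with ⟨hm, hm'⟩ | ⟨hm, hm'⟩ <;>
      rcases max_cases (M.V πs - M.V (alg.challenger h)) ε with ⟨hk, hk'⟩ | ⟨hk, hk'⟩ <;>
        rw [hm] at h1 <;> rw [hk] at h2 <;> linarith

end Gap

/-! ### Counting batches -/

theorem plays_append (M : TreeMDP S T A) (h : History S T A) (b : List ((S → A) × Node S T))
    (σ : T) : M.plays h σ ≤ M.plays (h ++ [b]) σ := by
  simp [plays]

theorem plays_lt_append (M : TreeMDP S T A) (h : History S T A) {b : List ((S → A) × Node S T)}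
    {e : (S → A) × Node S T} (he : e ∈ b) {σ : T} (hσ : M.Consistent e.1 σ) :
    M.plays h σ < M.plays (h ++ [b]) σ := by
  simp only [plays, List.flatten_append, List.countP_append, List.flatten_singleton]
  exact Nat.lt_add_of_pos_right (List.countP_pos_iff.2 ⟨e, he, by simpa using hσ⟩)

namespace LucbT

variable [Fintype S] [Fintype T] [Fintype A] [Nontrivial A] {M : TreeMDP S T A} {δ ε : ℝ}

/-- The samples for which the confidence bounds fail after `t` batches. -/
def unreliable (alg : LucbT M δ) (ε : ℝ) (πs : S → A) (t : ℕ) : Set (Sample S T A) :=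
  {ω | (alg.run ε ω t).length = t ∧ (∀ σ, M.plays (alg.run ε ω t) σ ≠ 0) ∧
      ¬ M.Reliable δ πs (alg.run ε ω t)}

theorem exists_plays_lt (alg : LucbT M δ) (hret : ∀ σ, M.ret σ ∈ Set.Icc (0 : ℝ) 1)
    (hε : ε ∈ Set.Ioo (0 : ℝ) 1) (hδ : δ ∈ Set.Ioo (0 : ℝ) 1) (πs : S → A) (ω : Sample S T A)
    {t : ℕ} (hrun : ¬ alg.Stops ε (alg.run ε ω t)) (hω : ω ∉ alg.unreliable ε πs t) :
    ∃ σ, M.plays (alg.run ε ω t) σ < M.plays (alg.run ε ω (t + 1)) σ ∧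
      (M.plays (alg.run ε ω t) σ : ℝ) ≤ 96 * confLog S T A δ t / M.leafGap πs ε σ ^ 2 := by
  have hlen := alg.length_run hrun
  have hL := confLog_nonneg S T A hδ t
  rw [alg.run_succ_of_not_stops hrun]
  set h := alg.run ε ω t with hh
  by_cases h0 : ∃ σ, M.plays h σ = 0
  · obtain ⟨σ, hσ0, hσ⟩ := alg.explore_spec h h0
    refine ⟨σ, M.plays_lt_append h (e := M.episode ω h.length 0 (alg.explore h)) ?_ hσ, ?_⟩
    · rw [batch, if_pos h0]; simp
    · rw [hσ0]; simp only [Nat.cast_zero]; positivity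
  · have hplays : ∀ σ, M.plays h σ ≠ 0 := fun σ hσ => h0 ⟨σ, hσ⟩
    have hrel : M.Reliable δ πs h := by
      by_contra hrel
      exact hω ⟨hlen, hplays, hrel⟩
    obtain ⟨π, hπ, hβ⟩ := M.exists_le_beta hret hε alg hplays hrun hrel
    obtain ⟨σ, hσ, hmin⟩ := M.exists_minPlays_eq h π
    refine ⟨σ, ?_, ?_⟩
    · rcases hπ with rfl | rfl
      · refine M.plays_lt_append h (e := M.episode ω h.length 0 (alg.top h)) ?_ hσ
        rw [batch, if_neg h0]; simp
      · refine M.plays_lt_append h (e := M.episode ω h.length 1 (alg.challenger h)) ?_ hσ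
        rw [batch, if_neg h0]; simp
    · have hΔ := M.leafGap_pos (πs := πs) hε.1 σ
      have hlog : Real.log (1 / deltaL δ h) = confLog S T A δ t := by rw [log_deltaL, hlen]
      have hb := mul_beta_sq (Nat.pos_of_ne_zero (hplays σ)) (δ := deltaL δ h) (by rwa [hlog])
      rw [hlog] at hb
      rw [hmin] at hβ
      have h1 : M.leafGap πs ε σ ≤ 6 * beta (M.plays h σ) (deltaL δ h) := by
        linarith [M.leafGap_le (πs := πs) (ε := ε) hσ]
      -- With nβ² equal to 8/3 times the logarithm, the threshold constant is 36 · 8/3 = 96.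
      have h2 : M.leafGap πs ε σ ^ 2 ≤ 36 * beta (M.plays h σ) (deltaL δ h) ^ 2 := by
        calc _ ≤ (6 * beta (M.plays h σ) (deltaL δ h)) ^ 2 := pow_le_pow_left₀ hΔ.le h1 2
          _ = _ := by ring
      rw [le_div_iff₀ (by positivity)]
      have h3 := mul_le_mul_of_nonneg_left h2 (Nat.cast_nonneg (α := ℝ) (M.plays h σ))
      linarith

-- The truncated counts form a potential: a batch with valid bounds plays some leaf whose count is
-- at most ⌊u σ⌋, raising its term by at least 1, and any other running batch is paid for by its
-- indicator.
open Classical in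
theorem length_run_le_sum (alg : LucbT M δ) (hret : ∀ σ, M.ret σ ∈ Set.Icc (0 : ℝ) 1)
    (hε : ε ∈ Set.Ioo (0 : ℝ) 1) (hδ : δ ∈ Set.Ioo (0 : ℝ) 1) (πs : S → A) (ω : Sample S T A)
    (u : T → ℝ) (t : ℕ)
    (hu : ∀ s < t, ∀ σ, 96 * confLog S T A δ s / M.leafGap πs ε σ ^ 2 ≤ u σ) :
    (alg.run ε ω t).length ≤ ∑ σ, min (M.plays (alg.run ε ω t) σ) (⌊u σ⌋₊ + 1) +
      ∑ s ∈ Finset.range t, if ω ∈ alg.unreliable ε πs s then 1 else 0 := by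
  induction t with
  | zero => simp [run]
  | succ t ih =>
    have ih := ih fun s hs => hu s (by omega)
    rw [Finset.sum_range_succ]
    by_cases hrun : alg.Stops ε (alg.run ε ω t)
    · rw [alg.run_succ_of_stops hrun]
      omega
    · have hmono : ∀ σ, M.plays (alg.run ε ω t) σ ≤ M.plays (alg.run ε ω (t + 1)) σ := by
        rw [alg.run_succ_of_not_stops hrun]
        exact M.plays_append _ _
      have hlen : (alg.run ε ω (t + 1)).length = (alg.run ε ω t).length + 1 := by
        rw [alg.run_succ_of_not_stops hrun]; simp
      by_cases hω : ω ∈ alg.unreliable ε πs t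
      · have : ∑ σ, min (M.plays (alg.run ε ω t) σ) (⌊u σ⌋₊ + 1) ≤
            ∑ σ, min (M.plays (alg.run ε ω (t + 1)) σ) (⌊u σ⌋₊ + 1) :=
          Finset.sum_le_sum fun σ _ => min_le_min_right _ (hmono σ)
        rw [if_pos hω]
        omega
      · obtain ⟨σ, hσ, hσu⟩ := alg.exists_plays_lt hret hε hδ πs ω hrun hω
        have hfl := Nat.le_floor (hσu.trans (hu t (Nat.lt_succ_self t) σ))
        have : ∑ σ, min (M.plays (alg.run ε ω t) σ) (⌊u σ⌋₊ + 1) <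
            ∑ σ, min (M.plays (alg.run ε ω (t + 1)) σ) (⌊u σ⌋₊ + 1) :=
          Finset.sum_lt_sum (fun σ _ => min_le_min_right _ (hmono σ))
            ⟨σ, Finset.mem_univ σ, by omega⟩
        omega

end LucbT

/-- The tangent bound log t ≤ t/x + log x removes the logarithm of the unknown. -/
theorem le_of_le_log {t d H P l B : ℝ} (ht : 0 < t) (hd : 1 ≤ d) (hH : d ≤ H)
    (hP : Real.log 2 ≤ P) (hl : 0 ≤ l)
    (h : t ≤ 96 * (Real.log 3 + P + l + (d + 4) * Real.log t) * H + d + B) :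
    t ≤ 12100 * (d * H * (l + Real.log H + P)) + 2 * B := by
  have hH1 : 1 ≤ H := hd.trans hH
  have hH0 : 0 < H := by linarith
  have hlH := Real.log_nonneg hH1
  have hl2 : 1 / 2 < Real.log 2 := by linarith [Real.log_two_gt_d9]
  set Q := l + Real.log H + P with hQ
  have hQ2 : Real.log 2 ≤ Q := by linarith
  have hl3 : Real.log 3 ≤ 2 * Q := by
    have h4 : Real.log 4 = 2 * Real.log 2 := by
      rw [show (4 : ℝ) = 2 ^ 2 by norm_num, Real.log_pow]; norm_num
    linarith [Real.log_le_log (by norm_num) (show (3 : ℝ) ≤ 4 by norm_num)]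
  -- Chosen so that the linear term becomes t/2. As d ≤ H, x ≤ 2¹⁰H², which gives log x ≤ 12Q.
  set x := 192 * H * (d + 4) with hx
  have hx0 : 0 < x := by positivity
  have hlogx : Real.log x ≤ 12 * Q := by
    have h1 : x ≤ 2 ^ 10 * H ^ 2 := by
      rw [hx]; nlinarith
    have h2 := Real.log_le_log hx0 h1
    rw [Real.log_mul (x := 2 ^ 10) (by positivity) (by positivity), Real.log_pow, Real.log_pow]
      at h2
    push_cast at h2
    linarith
  have hlogt : Real.log t ≤ t / x + Real.log x := by
    have h1 := Real.log_le_sub_one_of_pos (div_pos ht hx0)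
    rw [Real.log_div ht.ne' hx0.ne'] at h1
    linarith
  have h1 : 96 * H * (d + 4) * Real.log t ≤ t / 2 + 96 * H * (d + 4) * (12 * Q) := by
    have h2 := mul_le_mul_of_nonneg_left (hlogt.trans (add_le_add_right hlogx (t / x)))
      (show 0 ≤ 96 * H * (d + 4) by positivity)
    have h3 : 96 * H * (d + 4) * (t / x + 12 * Q) =
        t / 2 + 96 * H * (d + 4) * (12 * Q) := by
      rw [hx]; field_simp; ring
    linarith
  have hQ0 : 0 < Q := by linarith
  have hHQ : 0 < H * Q := by positivity
  have h2 : H * (Real.log 3 + P + l) ≤ H * (3 * Q) :=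
    mul_le_mul_of_nonneg_left (by linarith) hH0.le
  have h3 : H * Q ≤ d * (H * Q) := le_mul_of_one_le_left hHQ.le hd
  have h4 : d ≤ 2 * (d * (H * Q)) := by
    have : 1 ≤ 2 * (H * Q) := by nlinarith
    nlinarith
  -- With d + 4 ≤ 5d, doubling gives 2(96·3 + 96·5·12 + 2) = 12100.
  nlinarith

/-! ### From the number of batches to the expected number of episodes -/

namespace LucbT

variable [Fintype S] [Fintype T] [Fintype A] [Nontrivial A] {M : TreeMDP S T A} {δ ε : ℝ}

open Classical in
theorem length_run_le_add (alg : LucbT M δ) (hret : ∀ σ, M.ret σ ∈ Set.Icc (0 : ℝ) 1)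
    (hε : ε ∈ Set.Ioo (0 : ℝ) 1) (hδ : δ ∈ Set.Ioo (0 : ℝ) 1) (πs : S → A) (ω : Sample S T A)
    (t : ℕ) {d H P : ℝ} (hd : d = Fintype.card T) (hd1 : 1 ≤ d)
    (hH : H = ∑ σ, 1 / M.leafGap πs ε σ ^ 2) (hdH : d ≤ H)
    (hP : P = Fintype.card S * Real.log (Fintype.card A)) (hP2 : Real.log 2 ≤ P) :
    ((alg.run ε ω t).length : ℝ) ≤ 12100 * (d * H * (Real.log (1 / δ) + Real.log H + P)) +
      2 * ∑ s ∈ Finset.range t, if ω ∈ alg.unreliable ε πs s then 1 else 0 := by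
  have hl : 0 ≤ Real.log (1 / δ) := Real.log_nonneg (one_le_one_div hδ.1 hδ.2.le)
  induction t with
  | zero =>
    have := Real.log_nonneg (hd1.trans hdH)
    have := Real.log_nonneg (show (1 : ℝ) ≤ 2 by norm_num)
    have hH0 : 0 ≤ H := by linarith
    have hP0 : 0 ≤ P := by linarith
    simp only [run, List.length_nil, Nat.cast_zero, Finset.range_zero, Finset.sum_empty]
    positivity
  | succ t ih =>
    by_cases hrun : alg.Stops ε (alg.run ε ω t)
    · rw [alg.run_succ_of_stops hrun]
      refine ih.trans ?_
      rw [Finset.sum_range_succ]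
      have : (0 : ℝ) ≤ if ω ∈ alg.unreliable ε πs t then 1 else 0 := by positivity
      linarith
    · have hlen : (alg.run ε ω (t + 1)).length = t + 1 := by
        rw [alg.run_succ_of_not_stops hrun, List.length_append, alg.length_run hrun]; simp
      -- The logarithm of the latest batch dominates all earlier ones. Since the run has exactly `t
      -- + 1` batches, the count becomes an inequality for its own length.
      set L := Real.log 3 + P + Real.log (1 / δ) + (d + 4) * Real.log ((t + 1 : ℕ) : ℝ) with hL
      have hmono : ∀ s < t + 1, confLog S T A δ s ≤ L := by
        intro s hs
        rw [confLog_eq S T A hδ.1, hL, hP, hd]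
        have : Real.log ((s + 1 : ℕ) : ℝ) ≤ Real.log ((t + 1 : ℕ) : ℝ) :=
          Real.log_le_log (by positivity) (by exact_mod_cast hs)
        gcongr
      have hL0 : 0 ≤ L := (confLog_nonneg S T A hδ t).trans (hmono t (Nat.lt_succ_self t))
      have hsum := alg.length_run_le_sum hret hε hδ πs ω
        (fun σ => 96 * L * (1 / M.leafGap πs ε σ ^ 2)) (t + 1) fun s hs σ => by
          rw [mul_one_div]
          have := hmono s hs
          gcongr
      rw [hlen] at hsum ⊢
      have hmin : (∑ σ, min (M.plays (alg.run ε ω (t + 1)) σ)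
          (⌊96 * L * (1 / M.leafGap πs ε σ ^ 2)⌋₊ + 1) : ℕ) ≤ 96 * L * H + d := by
        rw [hH, hd, Finset.mul_sum, ← nsmul_one (Fintype.card T), ← Finset.card_univ,
          ← Finset.sum_const, ← Finset.sum_add_distrib, Nat.cast_sum]
        refine Finset.sum_le_sum fun σ _ => ?_
        refine (Nat.cast_le.2 (min_le_right _ _)).trans ?_
        push_cast
        have := Nat.floor_le (show 0 ≤ 96 * L * (1 / M.leafGap πs ε σ ^ 2) by positivity)
        linarith
      refine le_of_le_log (by positivity) hd1 hdH hP2 hl ?_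
      have hsum' : ((t + 1 : ℕ) : ℝ) ≤ ((∑ σ, min (M.plays (alg.run ε ω (t + 1)) σ)
          (⌊96 * L * (1 / M.leafGap πs ε σ ^ 2)⌋₊ + 1) : ℕ) : ℝ) +
          ∑ s ∈ Finset.range (t + 1), if ω ∈ alg.unreliable ε πs s then 1 else 0 := by
        refine (Nat.cast_le (α := ℝ).2 hsum).trans_eq ?_
        rw [Nat.cast_add]
        congr 1
        push_cast
        rfl
      linarith

theorem expectedEpisodes_le (alg : LucbT M δ) (hret : ∀ σ, M.ret σ ∈ Set.Icc (0 : ℝ) 1)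
    (hδ : δ ∈ Set.Ioo (0 : ℝ) 1) (πs : S → A) {R : ℝ} (hR : 0 ≤ R)
    (hlen : ∀ ω t, ((alg.run ε ω t).length : ℝ) ≤
      R + 2 * ∑ s ∈ Finset.range t, open Classical in
        if ω ∈ alg.unreliable ε πs s then 1 else 0) :
    alg.expectedEpisodes ε ≤ ENNReal.ofReal (2 * R + 4 * ∑' t : ℕ, 64 / ((t + 1 : ℕ) : ℝ) ^ 2) := by
  classical
  have hsummable : Summable fun t : ℕ => 64 / ((t + 1 : ℕ) : ℝ) ^ 2 := by
    have := (summable_nat_add_iff 1).2 (Real.summable_one_div_nat_pow.2 (one_lt_two))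
    simpa only [mul_one_div] using this.mul_left 64
  -- Measurable hulls have the same measure, so the failure events need not be shown measurable.
  let U : ℕ → Set (Sample S T A) := fun t => toMeasurable M.env (alg.unreliable ε πs t)
  have hU : ∀ t, MeasurableSet (U t) := fun t => measurableSet_toMeasurable _ _
  have hpt : ∀ ω, alg.episodes ε ω ≤
      ENNReal.ofReal (2 * R) + 4 * ∑' t, (U t).indicator 1 ω := by
    intro ω
    refine iSup_le fun t => ?_
    have h1 : (numEpisodes (alg.run ε ω t) : ℝ) ≤ 2 * R + 4 * ∑ s ∈ Finset.range t,
        if ω ∈ alg.unreliable ε πs s then 1 else 0 := by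
      have h2 : (numEpisodes (alg.run ε ω t) : ℝ) ≤ 2 * (alg.run ε ω t).length := by
        exact_mod_cast numEpisodes_run_le alg ε ω t
      linarith [hlen ω t]
    rw [← ENNReal.ofReal_natCast]
    refine (ENNReal.ofReal_le_ofReal h1).trans ?_
    rw [ENNReal.ofReal_add (by positivity)
      (mul_nonneg (by norm_num) (Finset.sum_nonneg fun s _ => by positivity)),
      ENNReal.ofReal_mul (p := 4) (by norm_num),
      ENNReal.ofReal_sum_of_nonneg fun s _ => by positivity]
    gcongr
    · simp
    · refine le_trans (Finset.sum_le_sum fun s _ => ?_) (ENNReal.sum_le_tsum (Finset.range t))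
      split_ifs with hs
      · rw [Set.indicator_of_mem (subset_toMeasurable _ _ hs)]; simp
      · simp
  calc alg.expectedEpisodes ε
      ≤ ∫⁻ ω, (ENNReal.ofReal (2 * R) + 4 * ∑' t, (U t).indicator 1 ω) ∂M.env :=
        lintegral_mono hpt
    _ = ENNReal.ofReal (2 * R) + 4 * ∑' t, M.env (alg.unreliable ε πs t) := by
        rw [lintegral_add_left measurable_const, lintegral_const_mul' _ _ (by simp),
          lintegral_tsum fun t => (measurable_one.indicator (hU t)).aemeasurable]
        simp only [lintegral_indicator_one (hU _), lintegral_const, measure_univ, mul_one, U,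
          measure_toMeasurable]
    _ ≤ ENNReal.ofReal (2 * R) + 4 * ∑' t : ℕ, ENNReal.ofReal (64 / ((t + 1 : ℕ) : ℝ) ^ 2) := by
        gcongr with t
        exact alg.env_unreliable_le ε hret hδ πs t
    _ = ENNReal.ofReal (2 * R + 4 * ∑' t : ℕ, 64 / ((t + 1 : ℕ) : ℝ) ^ 2) := by
        rw [← ENNReal.ofReal_tsum_of_nonneg (fun t => by positivity) hsummable,
          ENNReal.ofReal_add (by positivity)
            (mul_nonneg (by norm_num) (tsum_nonneg fun t => by positivity)),
          ENNReal.ofReal_mul (p := 4) (by norm_num)]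
        simp

end LucbT

end TreeMDP

end

theorem theorem2 :
    ∃ C : ℝ, 0 < C ∧
      ∀ (S T A : Type*) [Fintype S] [Fintype T] [Fintype A] [Nontrivial A]
        (M : TreeMDP S T A), (∀ σ : T, M.ret σ ∈ Set.Icc (0 : ℝ) 1) →
      ∀ πs : S → A, M.IsOptimal πs →
      ∀ ε ∈ Set.Ioo (0 : ℝ) 1, ∀ δ ∈ Set.Ioo (0 : ℝ) 1, ∀ alg : TreeMDP.LucbT M δ,
        alg.expectedEpisodes ε ≤ ENNReal.ofReal (C *
          ∑ σ : T, (Fintype.card T : ℝ) / M.leafGap πs ε σ ^ 2 *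
            (Real.log (1 / δ) + Real.log (∑ σ' : T, 1 / M.leafGap πs ε σ' ^ 2)
              + (Fintype.card S : ℝ) * Real.log (Fintype.card A : ℝ))) := by
  set K := ∑' t : ℕ, 64 / ((t + 1 : ℕ) : ℝ) ^ 2 with hK
  have hK0 : 0 ≤ K := tsum_nonneg fun t => by positivity
  -- Two episodes per batch give 2 · 12100. The additive 4K is absorbed because d · H · Q ≥ 1/2.
  refine ⟨24200 + 8 * K, by positivity, ?_⟩
  intro S T A _ _ _ _ M hret πs _ ε hε δ hδ alg
  set d := (Fintype.card T : ℝ) with hd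
  set H := ∑ σ : T, 1 / M.leafGap πs ε σ ^ 2 with hH
  set P := (Fintype.card S : ℝ) * Real.log (Fintype.card A : ℝ) with hP
  have hd1 : 1 ≤ d := by
    obtain ⟨σ, -⟩ := M.exists_consistent πs
    have : Nonempty T := ⟨σ⟩
    exact Nat.one_le_cast.2 Fintype.card_pos
  have hdH : d ≤ H := by
    rw [hd, hH, ← nsmul_one (Fintype.card T), ← Finset.card_univ, ← Finset.sum_const]
    refine Finset.sum_le_sum fun σ _ => ?_
    have h0 := M.leafGap_pos (πs := πs) hε.1 σ
    rw [le_div_iff₀ (by positivity), one_mul]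
    exact pow_le_one₀ h0.le (M.leafGap_le_one hret hε.2.le σ)
  have hl2 : 1 / 2 < Real.log 2 := by linarith [Real.log_two_gt_d9]
  have hP2 : Real.log 2 ≤ P := by
    have : Nonempty S := ⟨M.root⟩
    have hS : (1 : ℝ) ≤ Fintype.card S := by exact_mod_cast Fintype.card_pos (α := S)
    have hA : (2 : ℝ) ≤ Fintype.card A := by exact_mod_cast Fintype.one_lt_card (α := A)
    have hlog := Real.log_le_log (by norm_num) hA
    rw [hP]
    nlinarith
  have hl : 0 ≤ Real.log (1 / δ) := Real.log_nonneg (one_le_one_div hδ.1 hδ.2.le)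
  have hlH := Real.log_nonneg (hd1.trans hdH)
  set Q := Real.log (1 / δ) + Real.log H + P with hQ
  have hsum : ∑ σ : T, d / M.leafGap πs ε σ ^ 2 * Q = d * H * Q := by
    rw [hH, Finset.mul_sum, Finset.sum_mul]
    simp only [mul_one_div]
  have hQ1 : 1 / 2 ≤ Q := by linarith
  have hdHQ : 1 / 2 ≤ d * H * Q := by
    have : 1 ≤ d * H := one_le_mul_of_one_le_of_one_le hd1 (hd1.trans hdH)
    nlinarith
  rw [hsum]
  refine (alg.expectedEpisodes_le hret hδ πs (R := 12100 * (d * H * Q)) (by linarith)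
    fun ω t => alg.length_run_le_add hret hε hδ πs ω t hd hd1 hH hdH hP hP2).trans
    (ENNReal.ofReal_le_ofReal ?_)
  rw [← hK]
  nlinarith
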